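/- Let $M_0=\partial([0,1]^2)$. A \emph{square metric space} is a metric space $X$ with all distances at most $2$, together with an injective map $S_X\colon M_0\to X$ such that (sq$_1$) $d_X(S_X(i,r),S_X(i,s))=|s-r|=d_X(S_X(r,i),S_X(s,i))$ for $i\in\{0,1\}$, $r,s\in[0,1]$, and (sq$_2$) $d_X(S_X(r,s),S_X(t,u))\ge |r-t|+|s-u|$ for $(r,s),(t,u)\in M_0$. Let $\mathsf{SquaMS}$ be the category of square metric spaces, whose morphisms are the short (non-expanding) maps $f$ with $f\circ S_X=S_Y$. Its initial object is $M_0$ with the path metric (shortest distance along the boundary of the square) and $S=\mathrm{id}$. Let $N=\{0,1,2\}^2$ and $M=N\setminus\{(1,1)\}$. For $I\in\{M,N\}$ let $I\otimes X=(I\times X)/{\sim}$, where $\sim$ is the equivalence relation generated by $((i,j),S_X(1,r))\sim((i+1,j),S_X(0,r))$ and $((i,j),S_X(r,1))\sim((i,j+1),S_X(r,0))$, $r\in[0,1]$, whenever both cells belong to $I$; write $m\otimes x$ for the class of $(m,x)$. The distance of two points of $I\otimes X$ is the infimum, over all finite paths in $I\times X$ between representatives, of the sum of the contributions of consecutive points,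 where a pair related by $\sim$ contributes $0$, any other pair $(m,x),(m,y)$ contributes $\frac13 d_X(x,y)$, and any other pair $(m,x),(n,y)$ with $m\ne n$ contributes $2$. The map $S_{I\otimes X}$ sends a point $p$ of $M_0$ to $(i,j)\otimes S_X(3p-(i,j))$, where $(i,j)\in M$ is any cell with $p\in\frac13((i,j)+[0,1]^2)$, so that each side of the new square consists of three copies of the corresponding side of $X$. With $I\otimes f\colon m\otimes x\mapsto m\otimes f(x)$ this defines endofunctors $M\otimes-$ and $N\otimes-$ of $\mathsf{SquaMS}$. \textbf{Theorem.} The category $\mathsf{SquaMS}$ has colimits of all $\omega$-chains, and both functors $M\otimes-$ and $N\otimes-$ preserve them: if $(C,(c_k)_k)$ is a colimit of a chain $A_0\to A_1\to\cdots$, then $(I\otimes C,(I\otimes c_k)_k)$ is a colimit of $I\otimes A_0\to I\otimes A_1\to\cdots$. Consequently, let $F$ be either of the two functors, let $!\colon M_0\to F M_0$ be the unique morphism, and let $(G,(g_k)_k)$ be a colimit of the initial chain \[ M_0\xrightarrow{\;!\;}FM_0\xrightarrow{F!}F^2M_0\xrightarrow{F^2!}\cdots . \] There is a unique morphism $\eta\colon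 FG\to G$ with $\eta\circ Fg_k=g_{k+1}$ for all $k$; the pair $(G,\eta)$ is an initial $F$-algebra, and $\eta$ is an isomorphism of $\mathsf{SquaMS}$ and an isometry. For $F=M\otimes-$ this yields an initial algebra $(G,\eta\colon M\otimes G\to G)$, and for $F=N\otimes-$ an initial algebra $(W,\lambda\colon N\otimes W\to W)$. The canonical maps $g_k\colon M^k\otimes M_0\to G$ are injective, and so are the corresponding maps $N^k\otimes M_0\to W$. -/

import Mathlib

universe u

open CategoryTheory CategoryTheory.Limits

namespace SquareMetric

noncomputable section

/-! ## The boundary of the unit square -/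

/-- The boundary of the unit square `[0,1]²`. -/
def M0 : Set (ℝ × ℝ) :=
  {p | ((p.1 = 0 ∨ p.1 = 1) ∧ p.2 ∈ Set.Icc (0 : ℝ) 1) ∨
       (p.1 ∈ Set.Icc (0 : ℝ) 1 ∧ (p.2 = 0 ∨ p.2 = 1))}

theorem M0_bounds (p : M0) : 0 ≤ p.1.1 ∧ p.1.1 ≤ 1 ∧ 0 ≤ p.1.2 ∧ p.1.2 ≤ 1 := by
  obtain ⟨⟨r, s⟩, h⟩ := p
  simp only [M0, Set.mem_ofPred_eq, Set.mem_Icc] at h ⊢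
  rcases h with ⟨h | h, h1, h2⟩ | ⟨⟨h1, h2⟩, h | h⟩ <;> subst h <;> norm_num [h1, h2]

theorem M0_sides (p : M0) : p.1.1 = 0 ∨ p.1.1 = 1 ∨ p.1.2 = 0 ∨ p.1.2 = 1 := by
  rcases p.2 with ⟨h | h, _⟩ | ⟨_, h | h⟩ <;> simp [h]

theorem M0_mk {r s : ℝ} (hr0 : 0 ≤ r) (hr1 : r ≤ 1) (hs0 : 0 ≤ s) (hs1 : s ≤ 1)
    (h : r = 0 ∨ r = 1 ∨ s = 0 ∨ s = 1) : (r, s) ∈ M0 := by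
  simp only [M0, Set.mem_ofPred_eq, Set.mem_Icc]
  tauto

/-! ## The category of square metric spaces -/

/-- A square metric space: a metric space bounded by `2` with an injective map `S` from the
boundary of the unit square such that distances along each side are those of the unit interval
and distances on the boundary dominate the taxicab distance. -/
structure SquaMS : Type (u + 1) where
  carrier : Type u
  [metric : MetricSpace carrier]
  S : M0 → carrier
  S_injective : Function.Injective S
  dist_le_two : ∀ x y : carrier, dist x y ≤ 2
  /-- distances along the sides `{0} × [0,1]` and `{1} × [0,1]` -/
  sq1_vertical : ∀ p q : M0, (p.1.1 = 0 ∨ p.1.1 = 1) → p.1.1 = q.1.1 →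
    dist (S p) (S q) = |q.1.2 - p.1.2|
  /-- distances along the sides `[0,1] × {0}` and `[0,1] × {1}` -/
  sq1_horizontal : ∀ p q : M0, (p.1.2 = 0 ∨ p.1.2 = 1) → p.1.2 = q.1.2 →
    dist (S p) (S q) = |q.1.1 - p.1.1|
  sq2 : ∀ p q : M0, |p.1.1 - q.1.1| + |p.1.2 - q.1.2| ≤ dist (S p) (S q)

attribute [instance] SquaMS.metric

/-- Morphisms of square metric spaces: short maps which preserve `S`. -/
structure SquaMS.Hom (X Y : SquaMS.{u}) where
  toFun : X.carrier → Y.carrier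
  short : ∀ x y, dist (toFun x) (toFun y) ≤ dist x y
  map_S : ∀ p, toFun (X.S p) = Y.S p

theorem SquaMS.Hom.ext' {X Y : SquaMS.{u}} {f g : SquaMS.Hom X Y}
    (h : ∀ x, f.toFun x = g.toFun x) : f = g := by
  cases f; cases g; congr; exact funext h

instance : Category SquaMS.{u} where
  Hom := SquaMS.Hom
  id X := ⟨fun x => x, fun _ _ => le_rfl, fun _ => rfl⟩
  comp f g := ⟨fun x => g.toFun (f.toFun x), fun x y => (g.short _ _).trans (f.short x y),
    fun p => by rw [f.map_S, g.map_S]⟩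

/-- The underlying map of a morphism. -/
def SquaMS.map {X Y : SquaMS.{u}} (f : X ⟶ Y) : X.carrier → Y.carrier :=
  SquaMS.Hom.toFun f

/-! ## The boundary with the path metric, as the initial object -/

/-- The path metric on the boundary of the unit square. For points on opposite sides it is the
length of the shorter of the two ways around; points which are on a common side or on adjacent
sides are joined by a monotone path along the boundary, so that it is the taxicab distance. -/
def pathDist (p q : M0) : ℝ :=
  if |p.1.1 - q.1.1| = 1 then 1 + min (p.1.2 + q.1.2) ((1 - p.1.2) + (1 - q.1.2))
  else if |p.1.2 - q.1.2| = 1 then 1 + min (p.1.1 + q.1.1) ((1 - p.1.1) + (1 - q.1.1))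
  else |p.1.1 - q.1.1| + |p.1.2 - q.1.2|

/-- `a` is the arc length parameter of the point `p`, counterclockwise from `(0,0)`. -/
def IsParam (p : M0) (a : ℝ) : Prop :=
  (p.1.2 = 0 ∧ a = p.1.1) ∨ (p.1.1 = 1 ∧ a = 1 + p.1.2) ∨
  (p.1.2 = 1 ∧ a = 3 - p.1.1) ∨ (p.1.1 = 0 ∧ a = 4 - p.1.2)

theorem exists_param (p : M0) : ∃ a, IsParam p a := by
  unfold IsParam
  rcases M0_sides p with h | h | h | h
  · exact ⟨4 - p.1.2, by simp [h]⟩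
  · exact ⟨1 + p.1.2, by simp [h]⟩
  · exact ⟨p.1.1, by simp [h]⟩
  · exact ⟨3 - p.1.1, by simp [h]⟩

theorem pathDist_eq {p q : M0} {a b : ℝ} (ha : IsParam p a) (hb : IsParam q b) :
    pathDist p q = min |a - b| (4 - |a - b|) := by
  obtain ⟨hp1, hp2, hp3, hp4⟩ := M0_bounds p
  obtain ⟨hq1, hq2, hq3, hq4⟩ := M0_bounds q
  obtain ⟨⟨r, s⟩, hp⟩ := p
  obtain ⟨⟨t, v⟩, hq⟩ := q
  unfold IsParam at ha hb
  unfold pathDist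
  dsimp only at *
  rcases ha with ⟨rfl, rfl⟩ | ⟨rfl, rfl⟩ | ⟨rfl, rfl⟩ | ⟨rfl, rfl⟩ <;>
  rcases hb with ⟨rfl, rfl⟩ | ⟨rfl, rfl⟩ | ⟨rfl, rfl⟩ | ⟨rfl, rfl⟩ <;>
  simp only [abs_eq_max_neg] <;>
  grind only [max_def, min_def]

theorem pathDist_triangle (p q t : M0) : pathDist p t ≤ pathDist p q + pathDist q t := by
  obtain ⟨a, ha⟩ := exists_param p
  obtain ⟨b, hb⟩ := exists_param q
  obtain ⟨c, hc⟩ := exists_param t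
  rw [pathDist_eq ha hb, pathDist_eq hb hc, pathDist_eq ha hc]
  have h1 : 0 ≤ a ∧ a ≤ 4 := by have := M0_bounds p; unfold IsParam at ha; grind
  have h2 : 0 ≤ b ∧ b ≤ 4 := by have := M0_bounds q; unfold IsParam at hb; grind
  have h3 : 0 ≤ c ∧ c ≤ 4 := by have := M0_bounds t; unfold IsParam at hc; grind
  simp only [abs_eq_max_neg]
  grind only [max_def, min_def]

theorem taxi_le_pathDist (p q : M0) : |p.1.1 - q.1.1| + |p.1.2 - q.1.2| ≤ pathDist p q := by
  have := M0_bounds p; have := M0_bounds q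
  unfold pathDist
  simp only [abs_eq_max_neg]
  grind only [max_def, min_def]

theorem pathDist_le_two (p q : M0) : pathDist p q ≤ 2 := by
  have := M0_bounds p; have := M0_bounds q
  unfold pathDist
  simp only [abs_eq_max_neg]
  grind only [max_def, min_def]

/-- The set `M0`, as a type without its subspace metric. -/
structure Boundary : Type u where
  pt : M0

instance : MetricSpace Boundary.{u} where
  dist a b := pathDist a.pt b.pt
  dist_self a := by simp [pathDist]
  dist_comm a b := by
    simp only [pathDist, abs_sub_comm a.pt.1.1, abs_sub_comm a.pt.1.2, add_comm a.pt.1.1,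
      add_comm a.pt.1.2, add_comm (1 - a.pt.1.1), add_comm (1 - a.pt.1.2)]
  dist_triangle a b c := pathDist_triangle _ _ _
  eq_of_dist_eq_zero := by
    rintro ⟨p⟩ ⟨q⟩ h
    have h1 := taxi_le_pathDist p q
    have h2 : pathDist p q = 0 := h
    have h3 := abs_nonneg (p.1.1 - q.1.1)
    have h4 := abs_nonneg (p.1.2 - q.1.2)
    congr 1
    apply Subtype.ext
    apply Prod.ext
    · exact sub_eq_zero.1 (abs_eq_zero.1 (by linarith))
    · exact sub_eq_zero.1 (abs_eq_zero.1 (by linarith))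

/-- The boundary of the unit square with the path metric and the identity map. -/
def boundaryObj : SquaMS.{u} where
  carrier := Boundary.{u}
  S p := ⟨p⟩
  S_injective p q h := by injection h
  dist_le_two x y := pathDist_le_two _ _
  sq1_vertical p q h h' := by
    change pathDist p q = _
    have := M0_bounds p; have := M0_bounds q
    unfold pathDist
    simp only [abs_eq_max_neg]
    grind only [max_def, min_def]
  sq1_horizontal p q h h' := by
    change pathDist p q = _
    have := M0_bounds p; have := M0_bounds q
    unfold pathDist
    simp only [abs_eq_max_neg]
    grind only [max_def, min_def]
  sq2 p q := taxi_le_pathDist p q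

theorem dist_S_same (X : SquaMS.{u}) (p q : M0)
    (h : (p.1.1 = q.1.1 ∧ (p.1.1 = 0 ∨ p.1.1 = 1)) ∨ (p.1.2 = q.1.2 ∧ (p.1.2 = 0 ∨ p.1.2 = 1))) :
    dist (X.S p) (X.S q) = |p.1.1 - q.1.1| + |p.1.2 - q.1.2| := by
  rcases h with ⟨h, h'⟩ | ⟨h, h'⟩
  · rw [X.sq1_vertical p q h' h, h, abs_sub_comm]; simp
  · rw [X.sq1_horizontal p q h' h, h, abs_sub_comm]; simp

theorem dist_S_le_pathDist (X : SquaMS.{u}) (p q : M0) : dist (X.S p) (X.S q) ≤ pathDist p q := by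
  have adj : ∀ p q : M0, (p.1.1 = 0 ∨ p.1.1 = 1) → (q.1.2 = 0 ∨ q.1.2 = 1) →
      dist (X.S p) (X.S q) ≤ |p.1.1 - q.1.1| + |p.1.2 - q.1.2| := by
    intro p q hp hq
    have bp := M0_bounds p
    have bq := M0_bounds q
    let c : M0 := ⟨(p.1.1, q.1.2), M0_mk bp.1 bp.2.1 bq.2.2.1 bq.2.2.2 (by tauto)⟩
    have h := dist_triangle (X.S p) (X.S c) (X.S q)
    rw [dist_S_same X p c (Or.inl ⟨rfl, hp⟩), dist_S_same X c q (Or.inr ⟨rfl, hq⟩)] at h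
    simp only [c, sub_self, abs_zero] at h
    linarith
  have corners : ∀ p q c c' : M0, _ := fun p q c c' =>
    dist_triangle4 (X.S p) (X.S c) (X.S c') (X.S q)
  have bp := M0_bounds p
  have bq := M0_bounds q
  have hle := taxi_le_pathDist p q
  by_cases hv : (p.1.1 = 0 ∨ p.1.1 = 1) ∧ (q.1.1 = 0 ∨ q.1.1 = 1)
  · by_cases he : p.1.1 = q.1.1
    · exact (dist_S_same X p q (Or.inl ⟨he, hv.1⟩)).le.trans hle
    · have h1 : |p.1.1 - q.1.1| = 1 := by
        rcases hv with ⟨h | h, h' | h'⟩ <;> simp [h, h'] at he ⊢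
      have way : ∀ f : ℝ, (f = 0 ∨ f = 1) →
          dist (X.S p) (X.S q) ≤ |p.1.2 - f| + 1 + |f - q.1.2| := by
        intro f hf
        have hf' : 0 ≤ f ∧ f ≤ 1 := by rcases hf with rfl | rfl <;> norm_num
        let c : M0 := ⟨(p.1.1, f), M0_mk bp.1 bp.2.1 hf'.1 hf'.2 (by tauto)⟩
        let c' : M0 := ⟨(q.1.1, f), M0_mk bq.1 bq.2.1 hf'.1 hf'.2 (by tauto)⟩
        have h := corners p q c c'
        rw [dist_S_same X p c (Or.inl ⟨rfl, hv.1⟩), dist_S_same X c' q (Or.inl ⟨rfl, hv.2⟩),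
          dist_S_same X c c' (Or.inr ⟨rfl, hf⟩)] at h
        simpa [h1, c, c'] using h
      have w0 := way 0 (Or.inl rfl)
      have w1 := way 1 (Or.inr rfl)
      rw [abs_of_nonneg (by linarith), abs_of_nonpos (by linarith)] at w0
      rw [abs_of_nonpos (by linarith), abs_of_nonneg (by linarith)] at w1
      unfold pathDist
      rw [if_pos h1, ← min_add_add_left]
      exact le_min (by linarith) (by linarith)
  by_cases hh : (p.1.2 = 0 ∨ p.1.2 = 1) ∧ (q.1.2 = 0 ∨ q.1.2 = 1)
  · by_cases he : p.1.2 = q.1.2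
    · exact (dist_S_same X p q (Or.inr ⟨he, hh.1⟩)).le.trans hle
    · have h1 : |p.1.2 - q.1.2| = 1 := by
        rcases hh with ⟨h | h, h' | h'⟩ <;> simp [h, h'] at he ⊢
      have h0 : ¬ |p.1.1 - q.1.1| = 1 := by
        intro h0
        apply hv
        rcases abs_cases (p.1.1 - q.1.1) with ⟨h, _⟩ | ⟨h, _⟩ <;> rw [h] at h0
        · exact ⟨Or.inr (by linarith), Or.inl (by linarith)⟩
        · exact ⟨Or.inl (by linarith), Or.inr (by linarith)⟩
      have way : ∀ f : ℝ, (f = 0 ∨ f = 1) →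
          dist (X.S p) (X.S q) ≤ |p.1.1 - f| + 1 + |f - q.1.1| := by
        intro f hf
        have hf' : 0 ≤ f ∧ f ≤ 1 := by rcases hf with rfl | rfl <;> norm_num
        let c : M0 := ⟨(f, p.1.2), M0_mk hf'.1 hf'.2 bp.2.2.1 bp.2.2.2 (by tauto)⟩
        let c' : M0 := ⟨(f, q.1.2), M0_mk hf'.1 hf'.2 bq.2.2.1 bq.2.2.2 (by tauto)⟩
        have h := corners p q c c'
        rw [dist_S_same X p c (Or.inr ⟨rfl, hh.1⟩), dist_S_same X c' q (Or.inr ⟨rfl, hh.2⟩),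
          dist_S_same X c c' (Or.inl ⟨rfl, hf⟩)] at h
        simpa [h1, c, c'] using h
      have w0 := way 0 (Or.inl rfl)
      have w1 := way 1 (Or.inr rfl)
      rw [abs_of_nonneg (by linarith), abs_of_nonpos (by linarith)] at w0
      rw [abs_of_nonpos (by linarith), abs_of_nonneg (by linarith)] at w1
      unfold pathDist
      rw [if_neg h0, if_pos h1, ← min_add_add_left]
      exact le_min (by linarith) (by linarith)
  have sp := M0_sides p
  have sq := M0_sides q
  by_cases hp : p.1.1 = 0 ∨ p.1.1 = 1
  · exact (adj p q hp (by tauto)).trans hle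
  · refine le_trans ?_ hle
    rw [dist_comm, abs_sub_comm p.1.1, abs_sub_comm p.1.2]
    exact adj q p (by tauto) (by tauto)

/-- The boundary with the path metric is initial: the unique morphism to `X` is `S_X`. -/
def boundaryInitial : IsInitial boundaryObj.{u} :=
  IsInitial.ofUniqueHom
    (fun X => ⟨fun b => X.S b.pt, fun b c => dist_S_le_pathDist X b.pt c.pt, fun _ => rfl⟩)
    (fun _ f => SquaMS.Hom.ext' fun b => SquaMS.Hom.map_S f b.pt)

/-! ## Gluing scaled copies -/

/-- The index set `M`: the cells `(column, row)` of the `3 × 3` grid except the central one. -/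
def idxM : Finset (Fin 3 × Fin 3) := Finset.univ.erase (1, 1)

/-- The index set `N`: all cells of the `3 × 3` grid. -/
def idxN : Finset (Fin 3 × Fin 3) := Finset.univ

/-- The index sets used for gluing, namely `M` and `N`: those which contain `M`. -/
class IsIndexSet (I : Finset (Fin 3 × Fin 3)) : Prop where
  outer : idxM ⊆ I

instance : IsIndexSet idxM := ⟨Finset.Subset.refl _⟩

instance : IsIndexSet idxN := ⟨Finset.subset_univ _⟩

/-- The generating pairs of the equivalence relation on `I × M0`: the right side of a cell is
identified with the left side of the cell to its right, `((i,j),(1,r)) ≈ ((i+1,j),(0,r))`, and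
the top side of a cell with the bottom side of the cell above it,
`((i,j),(r,1)) ≈ ((i,j+1),(r,0))`, whenever both cells belong to `I`. -/
def Edge (I : Finset (Fin 3 × Fin 3)) (a b : I × M0) : Prop :=
  ((b.1.1.1 : ℕ) = (a.1.1.1 : ℕ) + 1 ∧ b.1.1.2 = a.1.1.2 ∧
    a.2.1.1 = 1 ∧ b.2.1.1 = 0 ∧ a.2.1.2 = b.2.1.2) ∨
  (b.1.1.1 = a.1.1.1 ∧ (b.1.1.2 : ℕ) = (a.1.1.2 : ℕ) + 1 ∧
    a.2.1.2 = 1 ∧ b.2.1.2 = 0 ∧ a.2.1.1 = b.2.1.1)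

/-- The relation on `I × X` induced by `Edge` through `S_X`. -/
def Glue (I : Finset (Fin 3 × Fin 3)) (X : SquaMS.{u}) (a b : I × X.carrier) : Prop :=
  ∃ p q : M0, a.2 = X.S p ∧ b.2 = X.S q ∧ Edge I (a.1, p) (b.1, q)

/-- The equivalence relation `∼` on `I × X`: the symmetric, reflexive and transitive closure. -/
def glueSetoid (I : Finset (Fin 3 × Fin 3)) (X : SquaMS.{u}) : Setoid (I × X.carrier) :=
  Relation.EqvGen.setoid (Glue I X)

/-- The set `I ⊗ X = (I × X)/∼`. -/
def Tensor (I : Finset (Fin 3 × Fin 3)) (X : SquaMS.{u}) : Type u :=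
  Quotient (glueSetoid I X)

/-- The element `m ⊗ x`. -/
def Tensor.mk (I : Finset (Fin 3 × Fin 3)) (X : SquaMS.{u}) (a : I × X.carrier) : Tensor I X :=
  Quotient.mk (glueSetoid I X) a

/-- The metric on `I × X`: scaled by `1/3` within a copy, and `2` between different copies. -/
def prodDist (I : Finset (Fin 3 × Fin 3)) (X : SquaMS.{u}) (a b : I × X.carrier) : ℝ :=
  if a.1 = b.1 then (1 / 3) * dist a.2 b.2 else 2

open Classical in
/-- The contribution of a pair of consecutive points of a path: pairs related by `∼` count `0`. -/
def step (I : Finset (Fin 3 × Fin 3)) (X : SquaMS.{u}) (a b : I × X.carrier) : ℝ :=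
  if glueSetoid I X a b then 0 else prodDist I X a b

/-- The score of the finite path `f 0, f 1, …, f n` in `I × X`. -/
def score (I : Finset (Fin 3 × Fin 3)) (X : SquaMS.{u}) (n : ℕ) (f : ℕ → I × X.carrier) : ℝ :=
  ∑ k ∈ Finset.range n, step I X (f k) (f (k + 1))

/-- The scores of all finite paths in `I × X` from a representative of `y` to one of `z`. -/
def scores (I : Finset (Fin 3 × Fin 3)) (X : SquaMS.{u}) (y z : Tensor I X) : Set ℝ :=
  {s | ∃ (n : ℕ) (f : ℕ → I × X.carrier),
    Tensor.mk I X (f 0) = y ∧ Tensor.mk I X (f n) = z ∧ s = score I X n f}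

/-- The quotient metric on `I ⊗ X`. -/
def tensorDist (I : Finset (Fin 3 × Fin 3)) (X : SquaMS.{u}) (y z : Tensor I X) : ℝ :=
  sInf (scores I X y z)

section Metric

variable {I : Finset (Fin 3 × Fin 3)} {X : SquaMS.{u}}

theorem Tensor.mk_eq {a b : I × X.carrier} :
    Tensor.mk I X a = Tensor.mk I X b ↔ glueSetoid I X a b := Quotient.eq

theorem Tensor.exists_mk (y : Tensor I X) : ∃ a, Tensor.mk I X a = y := Quotient.exists_rep y

theorem prodDist_nonneg (a b : I × X.carrier) : 0 ≤ prodDist I X a b := by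
  unfold prodDist; split_ifs <;> positivity

theorem prodDist_le_two (a b : I × X.carrier) : prodDist I X a b ≤ 2 := by
  have := X.dist_le_two a.2 b.2
  unfold prodDist; split_ifs <;> linarith

theorem step_nonneg (a b : I × X.carrier) : 0 ≤ step I X a b := by
  unfold step; split_ifs
  exacts [le_rfl, prodDist_nonneg a b]

theorem step_le (a b : I × X.carrier) : step I X a b ≤ prodDist I X a b := by
  unfold step; split_ifs
  exacts [prodDist_nonneg a b, le_rfl]

theorem step_comm (a b : I × X.carrier) : step I X a b = step I X b a := by
  have h : glueSetoid I X a b ↔ glueSetoid I X b a :=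
    ⟨(glueSetoid I X).symm, (glueSetoid I X).symm⟩
  have h' : prodDist I X a b = prodDist I X b a := by
    unfold prodDist
    simp only [eq_comm (a := a.1), dist_comm a.2]
  unfold step
  by_cases hab : glueSetoid I X a b
  · rw [if_pos hab, if_pos (h.1 hab)]
  · rw [if_neg hab, if_neg (fun k => hab (h.2 k)), h']

theorem score_nonneg (n : ℕ) (f : ℕ → I × X.carrier) : 0 ≤ score I X n f :=
  Finset.sum_nonneg fun _ _ => step_nonneg _ _

theorem scores_bddBelow (y z : Tensor I X) : BddBelow (scores I X y z) := by
  refine ⟨0, ?_⟩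
  rintro s ⟨n, f, -, -, rfl⟩
  exact score_nonneg n f

theorem step_mem (a b : I × X.carrier) :
    step I X a b ∈ scores I X (Tensor.mk I X a) (Tensor.mk I X b) :=
  ⟨1, fun k => if k = 0 then a else b, by simp, by simp, by simp [score]⟩

theorem scores_nonempty (y z : Tensor I X) : (scores I X y z).Nonempty := by
  obtain ⟨a, rfl⟩ := y.exists_mk
  obtain ⟨b, rfl⟩ := z.exists_mk
  exact ⟨_, step_mem a b⟩

theorem tensorDist_le {y z : Tensor I X} {s : ℝ} (h : s ∈ scores I X y z) :
    tensorDist I X y z ≤ s := csInf_le (scores_bddBelow y z) h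

theorem tensorDist_nonneg (y z : Tensor I X) : 0 ≤ tensorDist I X y z := by
  apply Real.sInf_nonneg
  rintro s ⟨n, f, -, -, rfl⟩
  exact score_nonneg n f

theorem tensorDist_mk_le (a b : I × X.carrier) :
    tensorDist I X (Tensor.mk I X a) (Tensor.mk I X b) ≤ prodDist I X a b :=
  (tensorDist_le (step_mem a b)).trans (step_le a b)

theorem tensorDist_self (y : Tensor I X) : tensorDist I X y y = 0 := by
  obtain ⟨a, rfl⟩ := y.exists_mk
  refine le_antisymm ?_ (tensorDist_nonneg _ _)
  exact tensorDist_le ⟨0, fun _ => a, rfl, rfl, by simp [score]⟩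

theorem scores_comm {y z : Tensor I X} {s : ℝ} (h : s ∈ scores I X y z) :
    s ∈ scores I X z y := by
  obtain ⟨n, f, h0, hn, rfl⟩ := h
  refine ⟨n, fun k => f (n - k), by simpa using hn, by simpa using h0, ?_⟩
  unfold score
  rw [← Finset.sum_range_reflect]
  refine Finset.sum_congr rfl fun k hk => ?_
  have hk := Finset.mem_range.1 hk
  rw [step_comm]
  congr 2 <;> omega

theorem tensorDist_comm (y z : Tensor I X) : tensorDist I X y z = tensorDist I X z y := by
  unfold tensorDist
  congr 1
  ext s
  exact ⟨scores_comm, scores_comm⟩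

theorem scores_add {x y z : Tensor I X} {s t : ℝ} (hs : s ∈ scores I X x y)
    (ht : t ∈ scores I X y z) : s + t ∈ scores I X x z := by
  obtain ⟨n, f, h0, hn, rfl⟩ := hs
  obtain ⟨m, g, g0, gm, rfl⟩ := ht
  refine ⟨(n + 1) + m, fun k => if k ≤ n then f k else g (k - (n + 1)), by simpa using h0, ?_, ?_⟩
  · have : ¬ (n + 1 + m ≤ n) := by omega
    simpa [this] using gm
  · unfold score
    rw [Finset.sum_range_add, Finset.sum_range_succ]
    have e : step I X (f n) (g 0) = 0 := by
      unfold step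
      rw [if_pos (Tensor.mk_eq.1 (hn.trans g0.symm))]
    congr 1
    · have : ∀ k ∈ Finset.range n, step I X (f k) (f (k + 1)) =
          step I X (if k ≤ n then f k else g (k - (n + 1)))
            (if k + 1 ≤ n then f (k + 1) else g (k + 1 - (n + 1))) := by
        intro k hk
        have hk := Finset.mem_range.1 hk
        rw [if_pos (by omega), if_pos (by omega)]
      rw [Finset.sum_congr rfl this]
      simp [e]
    · refine Finset.sum_congr rfl fun k _ => ?_
      dsimp only
      rw [if_neg (by omega), if_neg (by omega)]
      congr 2 <;> omega

theorem tensorDist_triangle (x y z : Tensor I X) :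
    tensorDist I X x z ≤ tensorDist I X x y + tensorDist I X y z := by
  refine le_of_forall_pos_lt_add fun ε hε => ?_
  obtain ⟨s, hs, hs'⟩ := exists_lt_of_csInf_lt (scores_nonempty x y)
    (show tensorDist I X x y < tensorDist I X x y + ε / 2 by linarith)
  obtain ⟨t, ht, ht'⟩ := exists_lt_of_csInf_lt (scores_nonempty y z)
    (show tensorDist I X y z < tensorDist I X y z + ε / 2 by linarith)
  have := tensorDist_le (scores_add hs ht)
  linarith

/-- A function which is constant on the classes of `∼`, `1/3`-Lipschitz on each copy and of
oscillation at most `2` bounds the quotient metric from below. -/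
theorem le_tensorDist (h : I × X.carrier → ℝ) (h1 : ∀ a b, Glue I X a b → h a = h b)
    (h2 : ∀ m x y, |h (m, x) - h (m, y)| ≤ 1 / 3 * dist x y) (h3 : ∀ a b, |h a - h b| ≤ 2)
    (a b : I × X.carrier) :
    |h a - h b| ≤ tensorDist I X (Tensor.mk I X a) (Tensor.mk I X b) := by
  have inv : ∀ a b, glueSetoid I X a b → h a = h b := by
    intro a b hab
    induction hab with
    | rel _ _ h => exact h1 _ _ h
    | refl _ => rfl
    | symm _ _ _ ih => exact ih.symm
    | trans _ _ _ _ _ ih ih' => exact ih.trans ih'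
  have hstep : ∀ a b, |h a - h b| ≤ step I X a b := by
    rintro ⟨m, x⟩ ⟨n, y⟩
    unfold step
    split_ifs with hab
    · rw [inv _ _ hab]; simp
    · unfold prodDist
      split_ifs with hmn
      · dsimp only at hmn
        subst hmn
        exact h2 _ _ _
      · exact h3 _ _
  refine le_csInf (scores_nonempty _ _) ?_
  rintro s ⟨n, f, h0, hn, rfl⟩
  rw [← inv _ _ (Tensor.mk_eq.1 h0), ← inv _ _ (Tensor.mk_eq.1 hn)]
  clear hn
  induction n with
  | zero => simp [score]
  | succ n ih =>
    unfold score at ih ⊢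
    rw [Finset.sum_range_succ]
    have := hstep (f n) (f (n + 1))
    have := abs_sub_le (h (f 0)) (h (f n)) (h (f (n + 1)))
    linarith

/-- The position in the `3 × 3` grid of a point of the boundary of a cell. -/
def posX (a : I × M0) : ℝ := ((a.1.1.1 : ℕ) : ℝ) + a.2.1.1

/-- The position in the `3 × 3` grid of a point of the boundary of a cell. -/
def posY (a : I × M0) : ℝ := ((a.1.1.2 : ℕ) : ℝ) + a.2.1.2

theorem Edge.pos {a b : I × M0} (h : Edge I a b) : posX a = posX b ∧ posY a = posY b := by
  unfold posX posY
  rcases h with ⟨h1, h2, h3, h4, h5⟩ | ⟨h1, h2, h3, h4, h5⟩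
  · rw [h1, h2, h3, h4, h5]; push_cast; constructor <;> ring
  · rw [h1, h2, h3, h4, h5]; push_cast; constructor <;> ring

theorem coord_cases {i k : Fin 3} {r t : ℝ} (hr : 0 ≤ r ∧ r ≤ 1) (ht : 0 ≤ t ∧ t ≤ 1)
    (h : ((i : ℕ) : ℝ) + r = ((k : ℕ) : ℝ) + t) :
    (i = k ∧ r = t) ∨ ((k : ℕ) = (i : ℕ) + 1 ∧ r = 1 ∧ t = 0) ∨
      ((i : ℕ) = (k : ℕ) + 1 ∧ r = 0 ∧ t = 1) := by
  rcases lt_trichotomy (i : ℕ) (k : ℕ) with hik | hik | hik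
  · have h1 : ((i : ℕ) : ℝ) + 1 ≤ ((k : ℕ) : ℝ) := by exact_mod_cast hik
    refine Or.inr (Or.inl ⟨?_, by linarith, by linarith⟩)
    have : ((k : ℕ) : ℝ) = ((i : ℕ) : ℝ) + 1 := by linarith
    exact_mod_cast this
  · refine Or.inl ⟨Fin.ext hik, ?_⟩
    rw [hik] at h
    linarith
  · have h1 : ((k : ℕ) : ℝ) + 1 ≤ ((i : ℕ) : ℝ) := by exact_mod_cast hik
    refine Or.inr (Or.inr ⟨?_, by linarith, by linarith⟩)
    have : ((i : ℕ) : ℝ) = ((k : ℕ) : ℝ) + 1 := by linarith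
    exact_mod_cast this

theorem eqvGen_horizontal {a b : I × M0} (hj : a.1.1.2 = b.1.1.2) (hy : a.2.1.2 = b.2.1.2)
    (hx : posX a = posX b) : Relation.EqvGen (Edge I) a b := by
  have ha := M0_bounds a.2
  have hb := M0_bounds b.2
  rcases coord_cases ⟨ha.1, ha.2.1⟩ ⟨hb.1, hb.2.1⟩ hx with ⟨h1, h2⟩ | ⟨h1, h2, h3⟩ | ⟨h1, h2, h3⟩
  · have : a = b := Prod.ext (Subtype.ext (Prod.ext h1 hj)) (Subtype.ext (Prod.ext h2 hy))
    rw [this]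
    exact Relation.EqvGen.refl _
  · exact Relation.EqvGen.rel _ _ (Or.inl ⟨h1, hj.symm, h2, h3, hy⟩)
  · exact Relation.EqvGen.symm _ _ (Relation.EqvGen.rel _ _ (Or.inl ⟨h1, hj, h3, h2, hy.symm⟩))

theorem eqvGen_vertical {a b : I × M0} (hi : a.1.1.1 = b.1.1.1) (hx : a.2.1.1 = b.2.1.1)
    (hy : posY a = posY b) : Relation.EqvGen (Edge I) a b := by
  have ha := M0_bounds a.2
  have hb := M0_bounds b.2
  rcases coord_cases ha.2.2 hb.2.2 hy with ⟨h1, h2⟩ | ⟨h1, h2, h3⟩ | ⟨h1, h2, h3⟩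
  · have : a = b := Prod.ext (Subtype.ext (Prod.ext hi h1)) (Subtype.ext (Prod.ext hx h2))
    rw [this]
    exact Relation.EqvGen.refl _
  · exact Relation.EqvGen.rel _ _ (Or.inr ⟨hi.symm, h1, h2, h3, hx⟩)
  · exact Relation.EqvGen.symm _ _ (Relation.EqvGen.rel _ _ (Or.inr ⟨hi, h1, h3, h2, hx.symm⟩))

theorem mem_of_ne [IsIndexSet I] {c : Fin 3 × Fin 3} (h : c ≠ (1, 1)) : c ∈ I :=
  IsIndexSet.outer (Finset.mem_erase.2 ⟨h, Finset.mem_univ _⟩)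

theorem eqvGen_of_pos [IsIndexSet I] {a b : I × M0} (hx : posX a = posX b)
    (hy : posY a = posY b) : Relation.EqvGen (Edge I) a b := by
  have ha := M0_bounds a.2
  have hb := M0_bounds b.2
  rcases coord_cases ⟨ha.1, ha.2.1⟩ ⟨hb.1, hb.2.1⟩ hx with ⟨h1, h2⟩ | hx'
  · exact eqvGen_vertical h1 h2 hy
  rcases coord_cases ha.2.2 hb.2.2 hy with ⟨h1, h2⟩ | hy'
  · exact eqvGen_horizontal h1 h2 hx
  have ax : a.2.1.1 = 0 ∨ a.2.1.1 = 1 := by tauto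
  have bx : b.2.1.1 = 0 ∨ b.2.1.1 = 1 := by tauto
  have hne : a.1.1.1 ≠ b.1.1.1 := by
    intro h
    rw [h] at hx'
    omega
  by_cases hc : (a.1.1.1, b.1.1.2) = ((1, 1) : Fin 3 × Fin 3)
  · have hc' : (b.1.1.1, a.1.1.2) ≠ ((1, 1) : Fin 3 × Fin 3) := by
      intro h
      apply hne
      rw [(Prod.ext_iff.1 hc).1, (Prod.ext_iff.1 h).1]
    let c : I × M0 := (⟨(b.1.1.1, a.1.1.2), mem_of_ne hc'⟩,
      ⟨(b.2.1.1, a.2.1.2), M0_mk hb.1 hb.2.1 ha.2.2.1 ha.2.2.2 (by tauto)⟩)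
    exact Relation.EqvGen.trans _ c _ (eqvGen_horizontal rfl rfl hx) (eqvGen_vertical rfl rfl hy)
  · let c : I × M0 := (⟨(a.1.1.1, b.1.1.2), mem_of_ne hc⟩,
      ⟨(a.2.1.1, b.2.1.2), M0_mk ha.1 ha.2.1 hb.2.2.1 hb.2.2.2 (by tauto)⟩)
    exact Relation.EqvGen.trans _ c _ (eqvGen_vertical rfl rfl hy) (eqvGen_horizontal rfl rfl hx)

theorem glue_of_eqvGen {a b : I × M0} (h : Relation.EqvGen (Edge I) a b) :
    Tensor.mk I X (a.1, X.S a.2) = Tensor.mk I X (b.1, X.S b.2) := by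
  induction h with
  | rel a b h => exact Tensor.mk_eq.2 (Relation.EqvGen.rel _ _ ⟨a.2, b.2, rfl, rfl, h⟩)
  | refl _ => rfl
  | symm _ _ _ ih => exact ih.symm
  | trans _ _ _ _ _ ih ih' => exact ih.trans ih'

theorem mk_eq_of_pos [IsIndexSet I] {a b : I × M0} (hx : posX a = posX b)
    (hy : posY a = posY b) : Tensor.mk I X (a.1, X.S a.2) = Tensor.mk I X (b.1, X.S b.2) :=
  glue_of_eqvGen (eqvGen_of_pos hx hy)

theorem coord_le_two (i : Fin 3) : 0 ≤ ((i : ℕ) : ℝ) ∧ ((i : ℕ) : ℝ) ≤ 2 := by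
  have : (i : ℕ) ≤ 2 := by omega
  exact ⟨by positivity, by exact_mod_cast this⟩

theorem linear_bound {e e' i j g : ℝ} (he : e = 1 ∨ e = -1) (he' : e' = 1 ∨ e' = -1)
    (hi : 0 ≤ i) (hi' : i ≤ 2) (hj : 0 ≤ j) (hj' : j ≤ 2) (hg : (e + e') / 2 - 1 ≤ g)
    (hg' : g ≤ (e + e') / 2 + 1) : |(e * i + e' * j + g) / 3 - (e + e') / 2| ≤ 1 := by
  rw [abs_le]
  rcases he with rfl | rfl <;> rcases he' with rfl | rfl <;> constructor <;> linarith

theorem linear_le_tensorDist {e e' : ℝ} (he : e = 1 ∨ e = -1) (he' : e' = 1 ∨ e' = -1)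
    (a b : I × M0) :
    |(e * posX a + e' * posY a) / 3 - (e * posX b + e' * posY b) / 3| ≤
      tensorDist I X (Tensor.mk I X (a.1, X.S a.2)) (Tensor.mk I X (b.1, X.S b.2)) := by
  let L : M0 → ℝ := fun p => e * p.1.1 + e' * p.1.2
  have hL : ∀ p q, |L p - L q| ≤ dist (X.S p) (X.S q) := by
    intro p q
    refine le_trans ?_ (X.sq2 p q)
    have : L p - L q = e * (p.1.1 - q.1.1) + e' * (p.1.2 - q.1.2) := by simp only [L]; ring
    rw [this]
    refine (abs_add_le _ _).trans ?_
    rw [abs_mul, abs_mul]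
    rcases he with rfl | rfl <;> rcases he' with rfl | rfl <;> simp
  have : ∃ g : X.carrier → ℝ, (∀ x y, |g x - g y| ≤ dist x y) ∧ ∀ p, g (X.S p) = L p := by
    have : Nonempty M0 := ⟨a.2⟩
    have hinv : ∀ p, Function.invFun X.S (X.S p) = p := Function.leftInverse_invFun X.S_injective
    have hf : LipschitzOnWith 1 (fun x => L (Function.invFun X.S x)) (Set.range X.S) := by
      apply LipschitzOnWith.of_dist_le_mul
      rintro _ ⟨p, rfl⟩ _ ⟨q, rfl⟩
      simpa [hinv, Real.dist_eq] using hL p q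
    obtain ⟨g, hg, hg'⟩ := hf.extend_real
    refine ⟨g, fun x y => by simpa [Real.dist_eq] using hg.dist_le_mul x y, fun p => ?_⟩
    rw [← hg' ⟨p, rfl⟩]
    simp only [hinv]
  obtain ⟨g, hg, hgS⟩ := this
  let c := (e + e') / 2
  let g' : X.carrier → ℝ := fun x => max (c - 1) (min (c + 1) (g x))
  have hg' : ∀ x y, |g' x - g' y| ≤ dist x y := fun x y =>
    (abs_max_sub_max_le_max _ _ _ _).trans (by
      have h1 := abs_min_sub_min_le_max (c + 1) (g x) (c + 1) (g y)
      have h2 := hg x y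
      have h3 : 0 ≤ dist x y := dist_nonneg
      simp only [sub_self, abs_zero] at h1 ⊢
      exact max_le h3 (h1.trans (max_le h3 h2)))
  have hg'S : ∀ p, g' (X.S p) = L p := by
    intro p
    have hp := M0_bounds p
    simp only [g', hgS]
    have h1 : L p ≤ c + 1 := by
      simp only [L, c]
      rcases he with rfl | rfl <;> rcases he' with rfl | rfl <;> linarith
    have h2 : c - 1 ≤ L p := by
      simp only [L, c]
      rcases he with rfl | rfl <;> rcases he' with rfl | rfl <;> linarith
    rw [min_eq_right h1, max_eq_right h2]
  have hg'1 : ∀ x, c - 1 ≤ g' x := fun x => le_max_left _ _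
  have hg'2 : ∀ x, g' x ≤ c + 1 := fun x => max_le (by linarith) (min_le_left _ _)
  let h : I × X.carrier → ℝ := fun z =>
    (e * ((z.1.1.1 : ℕ) : ℝ) + e' * ((z.1.1.2 : ℕ) : ℝ) + g' z.2) / 3
  have hS : ∀ a : I × M0, h (a.1, X.S a.2) = (e * posX a + e' * posY a) / 3 := by
    intro a
    simp only [h, hg'S, L, posX, posY]
    ring
  rw [← hS a, ← hS b]
  apply le_tensorDist
  · rintro ⟨m, x⟩ ⟨n, y⟩ ⟨p, q, hp, hq, hE⟩
    dsimp only at hp hq hE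
    rw [hp, hq, hS (m, p), hS (n, q), hE.pos.1, hE.pos.2]
  · intro m x y
    have : h (m, x) - h (m, y) = (1 / 3) * (g' x - g' y) := by simp only [h]; ring
    rw [this, abs_mul, abs_of_pos (by norm_num : (0 : ℝ) < 1 / 3)]
    exact mul_le_mul_of_nonneg_left (hg' x y) (by norm_num)
  · have bound : ∀ z, |h z - c| ≤ 1 := by
      intro z
      have h1 := hg'1 z.2
      have h2 := hg'2 z.2
      obtain ⟨h3, h3'⟩ := coord_le_two z.1.1.1
      obtain ⟨h4, h4'⟩ := coord_le_two z.1.1.2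
      exact linear_bound he he' h3 h3' h4 h4' h1 h2
    intro z w
    have h1 := abs_le.1 (bound z)
    have h2 := abs_le.1 (bound w)
    rw [abs_le]
    constructor <;> linarith

theorem taxi_le_tensorDist (a b : I × M0) :
    (|posX a - posX b| + |posY a - posY b|) / 3 ≤
      tensorDist I X (Tensor.mk I X (a.1, X.S a.2)) (Tensor.mk I X (b.1, X.S b.2)) := by
  have h := fun e e' he he' => abs_le.1 (linear_le_tensorDist (I := I) (X := X)
    (e := e) (e' := e') he he' a b)
  have h1 := h 1 1 (by simp) (by simp)
  have h2 := h 1 (-1) (by simp) (by simp)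
  rcases abs_cases (posX a - posX b) with ⟨k, _⟩ | ⟨k, _⟩ <;>
  rcases abs_cases (posY a - posY b) with ⟨k', _⟩ | ⟨k', _⟩ <;> rw [k, k'] <;> linarith

theorem isClosed_range_S : IsClosed (Set.range X.S) := by
  have hV : ∀ e : ℝ, (e = 0 ∨ e = 1) → IsCompact (X.S '' {p | p.1.1 = e}) := by
    intro e he
    have he' : 0 ≤ e ∧ e ≤ 1 := by rcases he with rfl | rfl <;> norm_num
    let P : Set.Icc (0 : ℝ) 1 → M0 := fun t =>
      ⟨(e, t.1), M0_mk he'.1 he'.2 t.2.1 t.2.2 (by tauto)⟩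
    let f : Set.Icc (0 : ℝ) 1 → X.carrier := fun t => X.S (P t)
    have hf : Isometry f := Isometry.of_dist_eq fun s t => by
      refine (X.sq1_vertical (P s) (P t) he rfl).trans ?_
      rw [abs_sub_comm, Subtype.dist_eq, Real.dist_eq]
    convert isCompact_range hf.continuous using 1
    ext x
    constructor
    · rintro ⟨p, rfl, rfl⟩
      exact ⟨⟨p.1.2, (M0_bounds p).2.2⟩, rfl⟩
    · rintro ⟨t, rfl⟩
      exact ⟨_, rfl, rfl⟩
  have hH : ∀ e : ℝ, (e = 0 ∨ e = 1) → IsCompact (X.S '' {p | p.1.2 = e}) := by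
    intro e he
    have he' : 0 ≤ e ∧ e ≤ 1 := by rcases he with rfl | rfl <;> norm_num
    let P : Set.Icc (0 : ℝ) 1 → M0 := fun t =>
      ⟨(t.1, e), M0_mk t.2.1 t.2.2 he'.1 he'.2 (by tauto)⟩
    let f : Set.Icc (0 : ℝ) 1 → X.carrier := fun t => X.S (P t)
    have hf : Isometry f := Isometry.of_dist_eq fun s t => by
      refine (X.sq1_horizontal (P s) (P t) he rfl).trans ?_
      rw [abs_sub_comm, Subtype.dist_eq, Real.dist_eq]
    convert isCompact_range hf.continuous using 1
    ext x
    constructor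
    · rintro ⟨p, rfl, rfl⟩
      exact ⟨⟨p.1.1, (M0_bounds p).1, (M0_bounds p).2.1⟩, rfl⟩
    · rintro ⟨t, rfl⟩
      exact ⟨_, rfl, rfl⟩
  have hr : Set.range X.S = (X.S '' {p | p.1.1 = 0} ∪ X.S '' {p | p.1.1 = 1}) ∪
      (X.S '' {p | p.1.2 = 0} ∪ X.S '' {p | p.1.2 = 1}) := by
    ext x
    constructor
    · rintro ⟨p, rfl⟩
      rcases M0_sides p with h | h | h | h
      · exact Or.inl (Or.inl ⟨p, h, rfl⟩)
      · exact Or.inl (Or.inr ⟨p, h, rfl⟩)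
      · exact Or.inr (Or.inl ⟨p, h, rfl⟩)
      · exact Or.inr (Or.inr ⟨p, h, rfl⟩)
    · rintro ((⟨p, -, rfl⟩ | ⟨p, -, rfl⟩) | (⟨p, -, rfl⟩ | ⟨p, -, rfl⟩)) <;> exact ⟨p, rfl⟩
  rw [hr]
  exact (((hV 0 (by simp)).union (hV 1 (by simp))).union
    ((hH 0 (by simp)).union (hH 1 (by simp)))).isClosed

theorem eq_of_tensorDist_interior {m n : I} {x y : X.carrier} (hx : x ∉ Set.range X.S)
    (h : tensorDist I X (Tensor.mk I X (m, x)) (Tensor.mk I X (n, y)) = 0) :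
    Tensor.mk I X (m, x) = Tensor.mk I X (n, y) := by
  obtain ⟨δ, hδ, hball⟩ := Metric.isOpen_iff.1 (isClosed_range_S (X := X)).isOpen_compl x hx
  have hd : ∀ p, δ ≤ dist (X.S p) x := by
    intro p
    by_contra hlt
    exact hball (Metric.mem_ball.2 (not_le.1 hlt)) ⟨p, rfl⟩
  have hδ2 : δ ≤ 2 := (hd ⟨(0, 0), M0_mk (by simp) (by simp) (by simp) (by simp) (by simp)⟩).trans
    (X.dist_le_two _ _)
  let φ : I × X.carrier → ℝ := fun z => if z.1 = m then (1 / 3) * min (dist z.2 x) δ else δ / 3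
  have hφS : ∀ k p, φ (k, X.S p) = δ / 3 := by
    intro k p
    simp only [φ, min_eq_right (hd p)]
    split_ifs <;> ring
  have hφ : ∀ z, 0 ≤ φ z ∧ φ z ≤ δ / 3 := by
    intro z
    have h1 : 0 ≤ min (dist z.2 x) δ := le_min dist_nonneg hδ.le
    have h2 : min (dist z.2 x) δ ≤ δ := min_le_right _ _
    simp only [φ]
    split_ifs <;> constructor <;> linarith
  have key := le_tensorDist φ (by
      rintro ⟨k, _⟩ ⟨l, _⟩ ⟨p, q, rfl, rfl, -⟩
      rw [hφS, hφS]) (by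
      intro k z w
      simp only [φ]
      split_ifs
      · rw [← mul_sub, abs_mul, abs_of_pos (by norm_num : (0 : ℝ) < 1 / 3)]
        refine mul_le_mul_of_nonneg_left ?_ (by norm_num)
        refine (abs_min_sub_min_le_max _ _ _ _).trans (max_le ?_ (by simp))
        exact abs_dist_sub_le _ _ _
      · simp) (by
      intro z w
      have := hφ z
      have := hφ w
      rw [abs_le]
      constructor <;> linarith) (m, x) (n, y)
  rw [h] at key
  have h0 : φ (m, x) = 0 := by simp [φ, hδ.le]
  have h1 : φ (n, y) = 0 := by
    rw [h0, zero_sub, abs_neg] at key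
    exact abs_nonpos_iff.1 key
  by_cases hn : n = m
  · subst hn
    have h2 : min (dist y x) δ = 0 := by simpa [φ] using h1
    have h3 : dist y x = 0 := by
      rcases min_choice (dist y x) δ with h | h <;> rw [h] at h2
      · exact h2
      · exact absurd h2 hδ.ne'
    rw [dist_eq_zero.1 h3]
  · simp only [φ, if_neg hn] at h1
    linarith

theorem eq_of_tensorDist_eq_zero [IsIndexSet I] {y z : Tensor I X}
    (h : tensorDist I X y z = 0) : y = z := by
  obtain ⟨⟨m, x⟩, rfl⟩ := y.exists_mk
  obtain ⟨⟨n, w⟩, rfl⟩ := z.exists_mk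
  by_cases hx : x ∈ Set.range X.S
  · by_cases hw : w ∈ Set.range X.S
    · obtain ⟨p, rfl⟩ := hx
      obtain ⟨q, rfl⟩ := hw
      have h1 := taxi_le_tensorDist (I := I) (X := X) (m, p) (n, q)
      rw [h] at h1
      have h2 := abs_nonneg (posX (m, p) - posX (n, q))
      have h3 := abs_nonneg (posY (m, p) - posY (n, q))
      exact mk_eq_of_pos (a := (m, p)) (b := (n, q))
        (sub_eq_zero.1 (abs_eq_zero.1 (by linarith)))
        (sub_eq_zero.1 (abs_eq_zero.1 (by linarith)))
    · rw [tensorDist_comm] at h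
      exact (eq_of_tensorDist_interior hw h).symm
  · exact eq_of_tensorDist_interior hx h

end Metric

/-- `I ⊗ X` is a metric space with the quotient metric. -/
instance (I : Finset (Fin 3 × Fin 3)) [IsIndexSet I] (X : SquaMS.{u}) :
    MetricSpace (Tensor I X) where
  dist := tensorDist I X
  dist_self := tensorDist_self
  dist_comm := tensorDist_comm
  dist_triangle := tensorDist_triangle
  eq_of_dist_eq_zero := eq_of_tensorDist_eq_zero

/-! ## The functor -/

/-- The third of the unit interval that contains `r`. -/
def third (r : ℝ) : Fin 3 := if r ≤ 1 / 3 then 0 else if r ≤ 2 / 3 then 1 else 2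

theorem third_spec {r : ℝ} (h0 : 0 ≤ r) (h1 : r ≤ 1) :
    0 ≤ 3 * r - ((third r : ℕ) : ℝ) ∧ 3 * r - ((third r : ℕ) : ℝ) ≤ 1 := by
  unfold third
  split_ifs <;> norm_num <;> constructor <;> linarith

theorem third_zero : third 0 = 0 := by unfold third; norm_num

theorem third_one : third 1 = 2 := by unfold third; norm_num

/-- The cell that contains the point `p` of the boundary of the unit square. -/
def outerCell (p : M0) : Fin 3 × Fin 3 := (third p.1.1, third p.1.2)

theorem outerCell_ne (p : M0) : outerCell p ≠ (1, 1) := by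
  intro h
  have h1 := (Prod.ext_iff.1 h).1
  have h2 := (Prod.ext_iff.1 h).2
  simp only [outerCell] at h1 h2
  rcases M0_sides p with h | h | h | h
  · rw [h, third_zero] at h1; exact absurd h1 (by decide)
  · rw [h, third_one] at h1; exact absurd h1 (by decide)
  · rw [h, third_zero] at h2; exact absurd h2 (by decide)
  · rw [h, third_one] at h2; exact absurd h2 (by decide)

/-- The point `p`, in the coordinates of the cell that contains it. -/
def outerPoint (p : M0) : M0 :=
  ⟨(3 * p.1.1 - ((third p.1.1 : ℕ) : ℝ), 3 * p.1.2 - ((third p.1.2 : ℕ) : ℝ)), by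
    have hp := M0_bounds p
    have h1 := third_spec hp.1 hp.2.1
    have h2 := third_spec hp.2.2.1 hp.2.2.2
    refine M0_mk h1.1 h1.2 h2.1 h2.2 ?_
    rcases M0_sides p with h | h | h | h
    · left; rw [h, third_zero]; norm_num
    · right; left; rw [h, third_one]; norm_num
    · right; right; left; rw [h, third_zero]; norm_num
    · right; right; right; rw [h, third_one]; norm_num⟩

/-- The map `S` of `I ⊗ X`: each side consists of three copies of the corresponding side of `X`,
for example `S (0, r) = (0, j) ⊗ S_X (0, 3r - j)` if `j / 3 ≤ r ≤ (j + 1) / 3`. -/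
def tensorS (I : Finset (Fin 3 × Fin 3)) [IsIndexSet I] (X : SquaMS.{u}) (p : M0) : Tensor I X :=
  Tensor.mk I X (⟨outerCell p, mem_of_ne (outerCell_ne p)⟩, X.S (outerPoint p))

/-- The definition of `S` does not depend on the choice of the cell. -/
theorem tensorS_eq (I : Finset (Fin 3 × Fin 3)) [IsIndexSet I] (X : SquaMS.{u}) (p : M0)
    (a : I × M0) (hx : posX a = 3 * p.1.1) (hy : posY a = 3 * p.1.2) :
    tensorS I X p = Tensor.mk I X (a.1, X.S a.2) := by
  refine mk_eq_of_pos (a := (⟨outerCell p, mem_of_ne (outerCell_ne p)⟩, outerPoint p)) ?_ ?_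
  · rw [hx]; simp only [posX, outerCell, outerPoint]; ring
  · rw [hy]; simp only [posY, outerCell, outerPoint]; ring

theorem tensorS_sq2 (I : Finset (Fin 3 × Fin 3)) [IsIndexSet I] (X : SquaMS.{u}) (p q : M0) :
    |p.1.1 - q.1.1| + |p.1.2 - q.1.2| ≤ dist (tensorS I X p) (tensorS I X q) := by
  have h := taxi_le_tensorDist (I := I) (X := X)
    (⟨outerCell p, mem_of_ne (outerCell_ne p)⟩, outerPoint p)
    (⟨outerCell q, mem_of_ne (outerCell_ne q)⟩, outerPoint q)
  refine le_trans (le_of_eq ?_) h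
  simp only [posX, posY, outerCell, outerPoint]
  have e : ∀ (i k r t : ℝ), |i + (3 * r - i) - (k + (3 * t - k))| = 3 * |r - t| := by
    intro i k r t
    rw [← abs_of_pos (by norm_num : (0 : ℝ) < 3), ← abs_mul, abs_of_pos (by norm_num : (0 : ℝ) < 3)]
    congr 1; ring
  rw [e, e]; ring

/-- A map on the unit interval that is short on each third is short. -/
theorem short_of_thirds {Y : Type u} [MetricSpace Y] (f : Set.Icc (0 : ℝ) 1 → Y)
    (h : ∀ (i : Fin 3) (s t : Set.Icc (0 : ℝ) 1), ((i : ℕ) : ℝ) ≤ 3 * s.1 →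
      3 * s.1 ≤ ((i : ℕ) : ℝ) + 1 → ((i : ℕ) : ℝ) ≤ 3 * t.1 → 3 * t.1 ≤ ((i : ℕ) : ℝ) + 1 →
      dist (f s) (f t) ≤ |s.1 - t.1|) (s t : Set.Icc (0 : ℝ) 1) :
    dist (f s) (f t) ≤ |s.1 - t.1| := by
  wlog hst : s.1 ≤ t.1 generalizing s t
  · rw [dist_comm, abs_sub_comm]
    exact this t s (le_of_not_ge hst)
  rw [abs_of_nonpos (by linarith)]
  have h' : ∀ (i : Fin 3) (s t : Set.Icc (0 : ℝ) 1), s.1 ≤ t.1 → ((i : ℕ) : ℝ) ≤ 3 * s.1 →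
      3 * t.1 ≤ ((i : ℕ) : ℝ) + 1 → dist (f s) (f t) ≤ t.1 - s.1 := by
    intro i s t hst h1 h2
    have := h i s t h1 (by linarith) (by linarith) h2
    rwa [abs_of_nonpos (by linarith), neg_sub] at this
  obtain ⟨hs0, hs1⟩ := s.2
  obtain ⟨ht0, ht1⟩ := t.2
  obtain ⟨u, hu⟩ : ∃ u : Set.Icc (0 : ℝ) 1, u.1 = 1 / 3 :=
    ⟨⟨1 / 3, by norm_num, by norm_num⟩, rfl⟩
  obtain ⟨v, hv⟩ : ∃ v : Set.Icc (0 : ℝ) 1, v.1 = 2 / 3 :=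
    ⟨⟨2 / 3, by norm_num, by norm_num⟩, rfl⟩
  have z0 : ∀ s t : Set.Icc (0 : ℝ) 1, s.1 ≤ t.1 → 0 ≤ s.1 → t.1 ≤ 1 / 3 →
      dist (f s) (f t) ≤ t.1 - s.1 := fun s t k k' k'' =>
    h' 0 s t k (by simp only [Fin.val_zero, Nat.cast_zero]; linarith)
      (by simp only [Fin.val_zero, Nat.cast_zero]; linarith)
  have z1 : ∀ s t : Set.Icc (0 : ℝ) 1, s.1 ≤ t.1 → 1 / 3 ≤ s.1 → t.1 ≤ 2 / 3 →
      dist (f s) (f t) ≤ t.1 - s.1 := fun s t k k' k'' =>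
    h' 1 s t k (by simp only [Fin.val_one, Nat.cast_one]; linarith)
      (by simp only [Fin.val_one, Nat.cast_one]; linarith)
  have z2 : ∀ s t : Set.Icc (0 : ℝ) 1, s.1 ≤ t.1 → 2 / 3 ≤ s.1 → t.1 ≤ 1 →
      dist (f s) (f t) ≤ t.1 - s.1 := fun s t k k' k'' =>
    h' 2 s t k (by simp only [Fin.val_two, Nat.cast_ofNat]; linarith)
      (by simp only [Fin.val_two, Nat.cast_ofNat]; linarith)
  have tu := dist_triangle (f s) (f u) (f t)
  have tv := dist_triangle (f s) (f v) (f t)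
  have tv' := dist_triangle (f u) (f v) (f t)
  have uv := z1 u v (by rw [hu, hv]; norm_num) hu.ge hv.le
  by_cases h1 : s.1 ≤ 1 / 3
  · have su := z0 s u (by linarith) hs0 hu.le
    by_cases h2 : t.1 ≤ 1 / 3
    · linarith [z0 s t hst hs0 (by linarith)]
    by_cases h3 : t.1 ≤ 2 / 3
    · linarith [z1 u t (by linarith) hu.ge (by linarith)]
    · linarith [z2 v t (by linarith) hv.ge (by linarith)]
  by_cases h4 : s.1 ≤ 2 / 3
  · have sv := z1 s v (by linarith) (by linarith) hv.le
    by_cases h3 : t.1 ≤ 2 / 3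
    · linarith [z1 s t hst (by linarith) (by linarith)]
    · linarith [z2 v t (by linarith) hv.ge (by linarith)]
  · linarith [z2 s t hst (by linarith) (by linarith)]

theorem tensorS_vertical_le (I : Finset (Fin 3 × Fin 3)) [IsIndexSet I] (X : SquaMS.{u})
    (p q : M0) (he : p.1.1 = 0 ∨ p.1.1 = 1) (hpq : p.1.1 = q.1.1) :
    dist (tensorS I X p) (tensorS I X q) ≤ |p.1.2 - q.1.2| := by
  obtain ⟨⟨e, s⟩, hp⟩ := p
  obtain ⟨⟨e', t⟩, hq⟩ := q
  dsimp only at he hpq ⊢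
  subst hpq
  have he' : 0 ≤ e ∧ e ≤ 1 := by rcases he with rfl | rfl <;> norm_num
  have mem : ∀ t : ℝ, 0 ≤ t → t ≤ 1 → (e, t) ∈ M0 := fun t h0 h1 =>
    M0_mk he'.1 he'.2 h0 h1 (by tauto)
  refine short_of_thirds (fun t => tensorS I X ⟨(e, t.1), mem t.1 t.2.1 t.2.2⟩) ?_
    ⟨s, (M0_bounds ⟨_, hp⟩).2.2⟩ ⟨t, (M0_bounds ⟨_, hq⟩).2.2⟩
  intro i s t h1 h2 h3 h4
  have hc : ((third e, i) : Fin 3 × Fin 3) ≠ (1, 1) := by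
    intro h
    have h1 : third e = 1 := (Prod.ext_iff.1 h).1
    rcases he with rfl | rfl
    · rw [third_zero] at h1; exact absurd h1 (by decide)
    · rw [third_one] at h1; exact absurd h1 (by decide)
  have hcorner : 3 * e - ((third e : ℕ) : ℝ) = e := by
    rcases he with rfl | rfl
    · rw [third_zero]; norm_num
    · rw [third_one]; norm_num
  let a : ∀ t : Set.Icc (0 : ℝ) 1, ((i : ℕ) : ℝ) ≤ 3 * t.1 → 3 * t.1 ≤ ((i : ℕ) : ℝ) + 1 → M0 :=
    fun t h1 h2 => ⟨(e, 3 * t.1 - ((i : ℕ) : ℝ)), mem _ (by linarith) (by linarith)⟩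
  rw [tensorS_eq I X ⟨(e, s.1), mem s.1 s.2.1 s.2.2⟩ (⟨(third e, i), mem_of_ne hc⟩, a s h1 h2)
      (by simp only [posX, a]; linarith) (by simp only [posY, a]; ring),
    tensorS_eq I X ⟨(e, t.1), mem t.1 t.2.1 t.2.2⟩ (⟨(third e, i), mem_of_ne hc⟩, a t h3 h4)
      (by simp only [posX, a]; linarith) (by simp only [posY, a]; ring)]
  refine (tensorDist_mk_le _ _).trans ?_
  unfold prodDist
  rw [if_pos rfl, X.sq1_vertical (a s h1 h2) (a t h3 h4) he rfl, abs_sub_comm]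
  simp only [a]
  have e3 : 3 * s.1 - ((i : ℕ) : ℝ) - (3 * t.1 - ((i : ℕ) : ℝ)) = 3 * (s.1 - t.1) := by ring
  rw [e3, abs_mul, abs_of_pos (by norm_num : (0 : ℝ) < 3)]
  linarith

theorem tensorS_horizontal_le (I : Finset (Fin 3 × Fin 3)) [IsIndexSet I] (X : SquaMS.{u})
    (p q : M0) (he : p.1.2 = 0 ∨ p.1.2 = 1) (hpq : p.1.2 = q.1.2) :
    dist (tensorS I X p) (tensorS I X q) ≤ |p.1.1 - q.1.1| := by
  obtain ⟨⟨s, e⟩, hp⟩ := p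
  obtain ⟨⟨t, e'⟩, hq⟩ := q
  dsimp only at he hpq ⊢
  subst hpq
  have he' : 0 ≤ e ∧ e ≤ 1 := by rcases he with rfl | rfl <;> norm_num
  have mem : ∀ t : ℝ, 0 ≤ t → t ≤ 1 → (t, e) ∈ M0 := fun t h0 h1 =>
    M0_mk h0 h1 he'.1 he'.2 (by tauto)
  refine short_of_thirds (fun t => tensorS I X ⟨(t.1, e), mem t.1 t.2.1 t.2.2⟩) ?_
    ⟨s, (M0_bounds ⟨_, hp⟩).1, (M0_bounds ⟨_, hp⟩).2.1⟩
    ⟨t, (M0_bounds ⟨_, hq⟩).1, (M0_bounds ⟨_, hq⟩).2.1⟩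
  intro i s t h1 h2 h3 h4
  have hc : ((i, third e) : Fin 3 × Fin 3) ≠ (1, 1) := by
    intro h
    have h1 : third e = 1 := (Prod.ext_iff.1 h).2
    rcases he with rfl | rfl
    · rw [third_zero] at h1; exact absurd h1 (by decide)
    · rw [third_one] at h1; exact absurd h1 (by decide)
  have hcorner : 3 * e - ((third e : ℕ) : ℝ) = e := by
    rcases he with rfl | rfl
    · rw [third_zero]; norm_num
    · rw [third_one]; norm_num
  let a : ∀ t : Set.Icc (0 : ℝ) 1, ((i : ℕ) : ℝ) ≤ 3 * t.1 → 3 * t.1 ≤ ((i : ℕ) : ℝ) + 1 → M0 :=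
    fun t h1 h2 => ⟨(3 * t.1 - ((i : ℕ) : ℝ), e), mem _ (by linarith) (by linarith)⟩
  rw [tensorS_eq I X ⟨(s.1, e), mem s.1 s.2.1 s.2.2⟩ (⟨(i, third e), mem_of_ne hc⟩, a s h1 h2)
      (by simp only [posX, a]; ring) (by simp only [posY, a]; linarith),
    tensorS_eq I X ⟨(t.1, e), mem t.1 t.2.1 t.2.2⟩ (⟨(i, third e), mem_of_ne hc⟩, a t h3 h4)
      (by simp only [posX, a]; ring) (by simp only [posY, a]; linarith)]
  refine (tensorDist_mk_le _ _).trans ?_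
  unfold prodDist
  rw [if_pos rfl, X.sq1_horizontal (a s h1 h2) (a t h3 h4) he rfl, abs_sub_comm]
  simp only [a]
  have e3 : 3 * s.1 - ((i : ℕ) : ℝ) - (3 * t.1 - ((i : ℕ) : ℝ)) = 3 * (s.1 - t.1) := by ring
  rw [e3, abs_mul, abs_of_pos (by norm_num : (0 : ℝ) < 3)]
  linarith

/-- The square metric space `I ⊗ X`. -/
def tensorObj (I : Finset (Fin 3 × Fin 3)) [IsIndexSet I] (X : SquaMS.{u}) : SquaMS.{u} where
  carrier := Tensor I X
  S := tensorS I X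
  S_injective p q h := by
    have h1 := tensorS_sq2 I X p q
    rw [h, dist_self] at h1
    have h2 := abs_nonneg (p.1.1 - q.1.1)
    have h3 := abs_nonneg (p.1.2 - q.1.2)
    exact Subtype.ext (Prod.ext (sub_eq_zero.1 (abs_eq_zero.1 (by linarith)))
      (sub_eq_zero.1 (abs_eq_zero.1 (by linarith))))
  dist_le_two y z := by
    obtain ⟨a, rfl⟩ := y.exists_mk
    obtain ⟨b, rfl⟩ := z.exists_mk
    exact (tensorDist_mk_le a b).trans (prodDist_le_two a b)
  sq1_vertical p q he hpq := by
    rw [abs_sub_comm]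
    refine le_antisymm (tensorS_vertical_le I X p q he hpq) ?_
    have h := tensorS_sq2 I X p q
    rwa [hpq, sub_self, abs_zero, zero_add] at h
  sq1_horizontal p q he hpq := by
    rw [abs_sub_comm]
    refine le_antisymm (tensorS_horizontal_le I X p q he hpq) ?_
    have h := tensorS_sq2 I X p q
    rwa [hpq, sub_self, abs_zero, add_zero] at h
  sq2 := tensorS_sq2 I X

theorem glue_map {I : Finset (Fin 3 × Fin 3)} {X Y : SquaMS.{u}} (f : SquaMS.Hom X Y)
    (a b : I × X.carrier) (h : glueSetoid I X a b) :
    glueSetoid I Y (a.1, f.toFun a.2) (b.1, f.toFun b.2) := by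
  induction h with
  | rel a b h =>
    obtain ⟨p, q, hp, hq, hE⟩ := h
    refine Relation.EqvGen.rel _ _ ⟨p, q, ?_, ?_, hE⟩
    · rw [hp, f.map_S]
    · rw [hq, f.map_S]
  | refl _ => exact Relation.EqvGen.refl _
  | symm _ _ _ ih => exact Relation.EqvGen.symm _ _ ih
  | trans _ _ _ _ _ ih ih' => exact Relation.EqvGen.trans _ _ _ ih ih'

/-- The map `I ⊗ f`, with `m ⊗ x ↦ m ⊗ f x`. -/
def tensorMap (I : Finset (Fin 3 × Fin 3)) {X Y : SquaMS.{u}} (f : SquaMS.Hom X Y) :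
    Tensor I X → Tensor I Y :=
  Quotient.map (fun a => (a.1, f.toFun a.2)) (glue_map f)

theorem step_map_le {I : Finset (Fin 3 × Fin 3)} {X Y : SquaMS.{u}} (f : SquaMS.Hom X Y)
    (a b : I × X.carrier) :
    step I Y (a.1, f.toFun a.2) (b.1, f.toFun b.2) ≤ step I X a b := by
  by_cases h : glueSetoid I X a b
  · refine le_of_eq_of_le ?_ (step_nonneg a b)
    unfold step
    rw [if_pos (glue_map f a b h)]
  · refine (step_le _ _).trans ?_
    unfold step
    rw [if_neg h]
    unfold prodDist
    dsimp only
    split_ifs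
    · have := f.short a.2 b.2
      linarith
    · exact le_rfl

/-- The morphism `I ⊗ f`. -/
def tensorHom (I : Finset (Fin 3 × Fin 3)) [IsIndexSet I] {X Y : SquaMS.{u}}
    (f : SquaMS.Hom X Y) : SquaMS.Hom (tensorObj I X) (tensorObj I Y) where
  toFun := tensorMap I f
  short y z := by
    refine le_csInf (scores_nonempty (I := I) (X := X) y z) ?_
    rintro s ⟨n, g, h0, hn, rfl⟩
    refine le_trans (tensorDist_le ⟨n, fun k => ((g k).1, f.toFun (g k).2), ?_, ?_, rfl⟩) ?_
    · rw [← h0]; rfl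
    · rw [← hn]; rfl
    · exact Finset.sum_le_sum fun k _ => step_map_le f _ _
  map_S p := by
    change Tensor.mk I Y (_, f.toFun (X.S _)) = Tensor.mk I Y (_, Y.S _)
    rw [f.map_S]

/-- The endofunctor `I ⊗ -` of the category of square metric spaces. -/
def tensorFunctor (I : Finset (Fin 3 × Fin 3)) [IsIndexSet I] : SquaMS.{u} ⥤ SquaMS.{u} where
  obj X := tensorObj I X
  map f := tensorHom I f
  map_id X := SquaMS.Hom.ext' fun y => by
    obtain ⟨a, rfl⟩ := Tensor.exists_mk y
    rfl
  map_comp f g := SquaMS.Hom.ext' fun y => by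
    obtain ⟨a, rfl⟩ := Tensor.exists_mk y
    rfl

/-- The functor `M ⊗ -`. -/
def functorM : SquaMS.{u} ⥤ SquaMS.{u} := tensorFunctor idxM

/-- The functor `N ⊗ -`. -/
def functorN : SquaMS.{u} ⥤ SquaMS.{u} := tensorFunctor idxN

/-! ## The initial chain -/

/-- The iterates `F^k M₀`. -/
def iterObj (F : SquaMS.{u} ⥤ SquaMS.{u}) : ℕ → SquaMS.{u}
  | 0 => boundaryObj
  | k + 1 => F.obj (iterObj F k)

/-- The morphisms `F^k ! : F^k M₀ ⟶ F^(k+1) M₀`. -/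
def iterMap (F : SquaMS.{u} ⥤ SquaMS.{u}) : ∀ k : ℕ, iterObj F k ⟶ iterObj F (k + 1)
  | 0 => boundaryInitial.to (F.obj boundaryObj)
  | k + 1 => F.map (iterMap F k)

/-- The initial chain `M₀ ⟶ F M₀ ⟶ F² M₀ ⟶ ⋯` of an endofunctor `F`. -/
def initialChain (F : SquaMS.{u} ⥤ SquaMS.{u}) : ℕ ⥤ SquaMS.{u} :=
  Functor.ofSequence (iterMap F)

/-- The `k`-th morphism of a cocone on the initial chain. -/
def coconeMap {F : SquaMS.{u} ⥤ SquaMS.{u}} (c : Cocone (initialChain F)) (k : ℕ) :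
    iterObj F k ⟶ c.pt :=
  c.ι.app k

end

end SquareMetric

open SquareMetric

namespace SquareMetric

/-! ## Underlying maps -/

/-! The colimit of a chain is built by hand. On the disjoint union of the spaces, the distance of
two points is the infimum of the distances of their images at later stages. Transition maps are
short, so these distances decrease and the infimum is a limit; hence the triangle inequality.
Identifying points at distance `0` gives a metric space. The axioms of a square metric space survive
because transition maps preserve `S`: side lengths are constant along the chain, and the taxicab
lower bound passes to the infimum. A cocone of short maps descends, since it is short at every later
stage.

For preservation, the quotient metric of `I ⊗ C` is never compared with those of the `I ⊗ A k`.
Every colimit `C` is isomorphic to the explicit one, so each of its points comes from a stage, and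
each strict upper bound on a distance already holds at some stage. Compatible `K`-Lipschitz maps on
the stages therefore descend to a `K`-Lipschitz map on `C` (`exists_lipschitz_desc`). Given a cocone
on the chain `I ⊗ A k`, this is applied with `K = 1/3` to `x ↦ m ⊗ x`, one cell `m` at a time. The
resulting maps on `C` agree along glued sides, because boundary points come from stage `0`, and
`tensorDesc` assembles them: a gluing-compatible map that is `1/3`-Lipschitz on each cell, with
values in a space of diameter at most `2`, is short for the quotient metric.

The initial algebra is then Adámek's construction. Since `F` preserves the colimit `G`, the object
`F G` is a colimit of the initial chain without its first term, which yields `η`; initiality is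
checked on the legs, and `η` is invertible by Lambek's lemma, hence isometric. The legs are
injective by induction: the first is `S_G`, the functors preserve injectivity
(`tensorFunctor_map_injective`), and each leg is obtained from the previous one by applying `F` and
composing with `η`. -/

theorem SquaMS.map_comp {X Y Z : SquaMS.{u}} (f : X ⟶ Y) (g : Y ⟶ Z) (x : X.carrier) :
    SquaMS.map (f ≫ g) x = SquaMS.map g (SquaMS.map f x) := rfl

theorem SquaMS.map_id {X : SquaMS.{u}} (x : X.carrier) : SquaMS.map (𝟙 X) x = x := rfl

theorem SquaMS.map_S {X Y : SquaMS.{u}} (f : X ⟶ Y) (p : M0) : SquaMS.map f (X.S p) = Y.S p :=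
  SquaMS.Hom.map_S f p

theorem SquaMS.dist_map_le {X Y : SquaMS.{u}} (f : X ⟶ Y) (x y : X.carrier) :
    dist (SquaMS.map f x) (SquaMS.map f y) ≤ dist x y :=
  SquaMS.Hom.short f x y

theorem SquaMS.hom_ext {X Y : SquaMS.{u}} {f g : X ⟶ Y}
    (h : ∀ x, SquaMS.map f x = SquaMS.map g x) : f = g :=
  SquaMS.Hom.ext' h

/-- The morphism and its inverse are both short. -/
theorem SquaMS.isometry_of_isIso {X Y : SquaMS.{u}} (f : X ⟶ Y) [IsIso f] :
    Isometry (SquaMS.map f) := by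
  have hinv : ∀ x, SquaMS.map (inv f) (SquaMS.map f x) = x := fun x => by
    rw [← SquaMS.map_comp, IsIso.hom_inv_id, SquaMS.map_id]
  refine Isometry.of_dist_eq fun x y => le_antisymm (SquaMS.dist_map_le f x y) ?_
  have h := SquaMS.dist_map_le (inv f) (SquaMS.map f x) (SquaMS.map f y)
  rwa [hinv, hinv] at h

/-! ## Colimits of chains -/

section Chain

variable {A : ℕ ⥤ SquaMS.{u}}

/-- The transition maps of a chain. -/
def chainMap (A : ℕ ⥤ SquaMS.{u}) {k n : ℕ} (h : k ≤ n) (x : (A.obj k).carrier) :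
    (A.obj n).carrier :=
  SquaMS.map (A.map (homOfLE h)) x

theorem chainMap_refl {k : ℕ} (x : (A.obj k).carrier) : chainMap A le_rfl x = x := by
  have h : homOfLE (le_refl k) = 𝟙 k := rfl
  rw [chainMap, h, A.map_id, SquaMS.map_id]

theorem chainMap_trans {k l n : ℕ} (h : k ≤ l) (h' : l ≤ n) (x : (A.obj k).carrier) :
    chainMap A h' (chainMap A h x) = chainMap A (h.trans h') x := by
  rw [chainMap, chainMap, ← SquaMS.map_comp, ← A.map_comp]
  rfl

theorem chainMap_S {k n : ℕ} (h : k ≤ n) (p : M0) :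
    chainMap A h ((A.obj k).S p) = (A.obj n).S p :=
  SquaMS.map_S _ p

theorem dist_chainMap_le {k n : ℕ} (h : k ≤ n) (x y : (A.obj k).carrier) :
    dist (chainMap A h x) (chainMap A h y) ≤ dist x y :=
  SquaMS.dist_map_le _ x y

theorem cocone_chainMap (s : Cocone A) {k n : ℕ} (h : k ≤ n) (x : (A.obj k).carrier) :
    SquaMS.map (s.ι.app n) (chainMap A h x) = SquaMS.map (s.ι.app k) x := by
  rw [chainMap, ← SquaMS.map_comp, s.w]

/-- A point of one of the spaces of a chain. -/
structure ChainPoint (A : ℕ ⥤ SquaMS.{u}) : Type u where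
  stage : ℕ
  pt : (A.obj stage).carrier

/-- The distances of the images of two points at all later stages. -/
def stageDists (a b : ChainPoint A) : Set ℝ :=
  {r | ∃ (n : ℕ) (ha : a.stage ≤ n) (hb : b.stage ≤ n),
    r = dist (chainMap A ha a.pt) (chainMap A hb b.pt)}

/-- The limit of the distances of the images of two points. -/
noncomputable def chainDist (a b : ChainPoint A) : ℝ := sInf (stageDists a b)

theorem chainDist_le (a b : ChainPoint A) {n : ℕ} (ha : a.stage ≤ n) (hb : b.stage ≤ n) :
    chainDist a b ≤ dist (chainMap A ha a.pt) (chainMap A hb b.pt) := by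
  refine csInf_le ⟨0, ?_⟩ ⟨n, ha, hb, rfl⟩
  rintro r ⟨n, ha, hb, rfl⟩
  exact dist_nonneg

theorem stageDists_nonempty (a b : ChainPoint A) : (stageDists a b).Nonempty :=
  ⟨_, max a.stage b.stage, le_max_left _ _, le_max_right _ _, rfl⟩

theorem le_chainDist {a b : ChainPoint A} {r : ℝ}
    (h : ∀ (n : ℕ) (ha : a.stage ≤ n) (hb : b.stage ≤ n),
      r ≤ dist (chainMap A ha a.pt) (chainMap A hb b.pt)) : r ≤ chainDist a b := by
  refine le_csInf (stageDists_nonempty a b) ?_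
  rintro s ⟨n, ha, hb, rfl⟩
  exact h n ha hb

/-- Short transition maps make the stage distances nonincreasing, so a bound attained once persists.
This turns the infimum into a limit and lets several estimates be made at one common stage. -/
theorem exists_dist_lt_of_chainDist_lt {a b : ChainPoint A} {r : ℝ} (h : chainDist a b < r) :
    ∃ N : ℕ, ∀ (n : ℕ) (ha : a.stage ≤ n) (hb : b.stage ≤ n), N ≤ n →
      dist (chainMap A ha a.pt) (chainMap A hb b.pt) < r := by
  obtain ⟨s, ⟨N, ha', hb', rfl⟩, hs⟩ := exists_lt_of_csInf_lt (stageDists_nonempty a b) h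
  refine ⟨N, fun n ha hb hn => lt_of_le_of_lt ?_ hs⟩
  rw [← chainMap_trans ha' hn, ← chainMap_trans hb' hn]
  exact dist_chainMap_le hn _ _

theorem chainDist_self (a : ChainPoint A) : chainDist a a = 0 := by
  refine le_antisymm ((chainDist_le a a le_rfl le_rfl).trans_eq (dist_self _)) ?_
  exact le_chainDist fun _ _ _ => dist_nonneg

theorem chainDist_comm (a b : ChainPoint A) : chainDist a b = chainDist b a := by
  have h : ∀ a b : ChainPoint A, chainDist a b ≤ chainDist b a := fun a b =>
    le_chainDist fun n ha hb => (chainDist_le a b hb ha).trans_eq (dist_comm _ _)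
  exact le_antisymm (h a b) (h b a)

theorem chainDist_triangle (a b c : ChainPoint A) :
    chainDist a c ≤ chainDist a b + chainDist b c := by
  refine le_of_forall_pos_lt_add fun ε hε => ?_
  obtain ⟨N, hN⟩ := exists_dist_lt_of_chainDist_lt
    (show chainDist a b < chainDist a b + ε / 2 by linarith)
  obtain ⟨N', hN'⟩ := exists_dist_lt_of_chainDist_lt
    (show chainDist b c < chainDist b c + ε / 2 by linarith)
  -- The sum is a stage beyond all three points and both thresholds.
  let n := a.stage + b.stage + c.stage + N + N'
  have ha : a.stage ≤ n := by omega
  have hb : b.stage ≤ n := by omega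
  have hc : c.stage ≤ n := by omega
  have h1 := hN n ha hb (by omega)
  have h2 := hN' n hb hc (by omega)
  have h3 := chainDist_le a c ha hc
  have h4 := dist_triangle (chainMap A ha a.pt) (chainMap A hb b.pt) (chainMap A hc c.pt)
  linarith

theorem chainDist_S {p q : M0} {r : ℝ} (h : ∀ n, dist ((A.obj n).S p) ((A.obj n).S q) = r) :
    chainDist (A := A) ⟨0, (A.obj 0).S p⟩ ⟨0, (A.obj 0).S q⟩ = r := by
  have h' : ∀ n : ℕ, dist (chainMap A n.zero_le ((A.obj 0).S p))
      (chainMap A n.zero_le ((A.obj 0).S q)) = r := fun n => by rw [chainMap_S, chainMap_S, h]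
  exact le_antisymm ((chainDist_le (A := A) ⟨0, _⟩ ⟨0, _⟩ _ _).trans_eq (h' 0))
    (le_chainDist fun n _ _ => (h' n).ge)

theorem taxi_le_chainDist_S (p q : M0) : |p.1.1 - q.1.1| + |p.1.2 - q.1.2| ≤
    chainDist (A := A) ⟨0, (A.obj 0).S p⟩ ⟨0, (A.obj 0).S q⟩ := by
  refine le_chainDist fun n _ _ => ?_
  rw [chainMap_S, chainMap_S]
  exact (A.obj n).sq2 p q

/-- Only a pseudometric: a point has distance `0` from its own images at later stages, and images of
two points may also approach each other without ever meeting. -/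
noncomputable instance : PseudoMetricSpace (ChainPoint A) where
  dist := chainDist
  dist_self := chainDist_self
  dist_comm := chainDist_comm
  dist_triangle := chainDist_triangle

/-- The colimit of a chain: the metric space of its points with the limit distance. -/
noncomputable def chainColimit (A : ℕ ⥤ SquaMS.{u}) : SquaMS.{u} where
  carrier := SeparationQuotient (ChainPoint A)
  -- Stage `0` is a mere choice: transition maps preserve `S`, so every stage gives the same class.
  S p := SeparationQuotient.mk ⟨0, (A.obj 0).S p⟩
  S_injective p q h := by
    -- Injectivity of `S` at each stage would not exclude distances tending to `0`; the taxicab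
    -- bound, uniform in the stage, does.
    have h1 := taxi_le_chainDist_S (A := A) p q
    have h0 : chainDist (A := A) ⟨0, (A.obj 0).S p⟩ ⟨0, (A.obj 0).S q⟩ = 0 := by
      refine (SeparationQuotient.dist_mk (α := ChainPoint A) _ _).symm.trans ?_
      exact (congrArg (fun z => dist z _) h).trans (dist_self _)
    have h2 := abs_nonneg (p.1.1 - q.1.1)
    have h3 := abs_nonneg (p.1.2 - q.1.2)
    exact Subtype.ext (Prod.ext (sub_eq_zero.1 (abs_eq_zero.1 (by linarith)))
      (sub_eq_zero.1 (abs_eq_zero.1 (by linarith))))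
  dist_le_two x y := by
    obtain ⟨a, rfl⟩ := SeparationQuotient.surjective_mk x
    obtain ⟨b, rfl⟩ := SeparationQuotient.surjective_mk y
    rw [SeparationQuotient.dist_mk]
    exact (chainDist_le a b (le_max_left _ _) (le_max_right _ _)).trans (SquaMS.dist_le_two _ _ _)
  sq1_vertical p q he hpq := by
    rw [SeparationQuotient.dist_mk]
    exact chainDist_S fun n => (A.obj n).sq1_vertical p q he hpq
  sq1_horizontal p q he hpq := by
    rw [SeparationQuotient.dist_mk]
    exact chainDist_S fun n => (A.obj n).sq1_horizontal p q he hpq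
  sq2 p q := by
    rw [SeparationQuotient.dist_mk]
    exact taxi_le_chainDist_S p q

/-- The two points have the same image at stage `n`, so their limit distance is `0`. -/
theorem chainColimit_mk_chainMap {k n : ℕ} (h : k ≤ n) (x : (A.obj k).carrier) :
    SeparationQuotient.mk (⟨n, chainMap A h x⟩ : ChainPoint A) = SeparationQuotient.mk ⟨k, x⟩ := by
  refine SeparationQuotient.mk_eq_mk.2 (Metric.inseparable_iff.2 ?_)
  refine le_antisymm ((chainDist_le _ _ le_rfl h).trans_eq ?_) dist_nonneg
  rw [chainMap_refl, dist_self]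

/-- The canonical cocone on a chain. -/
noncomputable def chainCocone (A : ℕ ⥤ SquaMS.{u}) : Cocone A where
  pt := chainColimit A
  ι :=
    { app := fun k =>
        { toFun := fun x => SeparationQuotient.mk ⟨k, x⟩
          short := fun x y => (chainDist_le (A := A) ⟨k, x⟩ ⟨k, y⟩ le_rfl le_rfl).trans
            (dist_chainMap_le _ _ _)
          map_S := fun p => by
            rw [← chainMap_S (Nat.zero_le k) p]
            exact chainColimit_mk_chainMap _ _ }
      naturality := fun _ _ f => SquaMS.hom_ext fun x => chainColimit_mk_chainMap (leOfHom f) x }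

/-- The cocone factors through every later stage by a short map, so it is bounded by every term of
the infimum. This gives both well-definedness and shortness of the descended map. -/
theorem dist_cocone_le_chainDist (s : Cocone A) (a b : ChainPoint A) :
    dist (SquaMS.map (s.ι.app a.stage) a.pt) (SquaMS.map (s.ι.app b.stage) b.pt) ≤
      chainDist a b := by
  refine le_chainDist fun n ha hb => ?_
  rw [← cocone_chainMap s ha, ← cocone_chainMap s hb]
  exact SquaMS.dist_map_le _ _ _

/-- The canonical cocone is a colimit. -/
noncomputable def chainIsColimit (A : ℕ ⥤ SquaMS.{u}) : IsColimit (chainCocone A) where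
  desc s :=
    { toFun := SeparationQuotient.lift (fun a => SquaMS.map (s.ι.app a.stage) a.pt)
        fun a b h => dist_le_zero.1
          ((dist_cocone_le_chainDist s a b).trans_eq (Metric.inseparable_iff.1 h))
      short := fun x y => by
        obtain ⟨a, rfl⟩ := SeparationQuotient.surjective_mk x
        obtain ⟨b, rfl⟩ := SeparationQuotient.surjective_mk y
        exact (dist_cocone_le_chainDist s a b).trans_eq (SeparationQuotient.dist_mk a b).symm
      map_S := fun p => SquaMS.map_S (s.ι.app 0) p }
  fac _ _ := rfl
  uniq s f hf := SquaMS.hom_ext fun x => by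
    obtain ⟨a, rfl⟩ := SeparationQuotient.surjective_mk x
    exact congrArg (fun g => SquaMS.map g a.pt) (hf a.stage)

theorem hasColimitsOfShape_nat : HasColimitsOfShape ℕ SquaMS.{u} :=
  ⟨fun A => ⟨⟨⟨chainCocone A, chainIsColimit A⟩⟩⟩⟩

/-! ## Points and distances of a colimit -/

/-- True by construction for `chainColimit`, and transported to an arbitrary colimit along the
comparison isomorphism, which commutes with the legs. -/
theorem exists_rep_of_isColimit {c : Cocone A} (hc : IsColimit c) (y : c.pt.carrier) :
    ∃ k x, SquaMS.map (c.ι.app k) x = y := by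
  let e := hc.coconePointUniqueUpToIso (chainIsColimit A)
  obtain ⟨a, ha⟩ := SeparationQuotient.surjective_mk (SquaMS.map e.hom y)
  refine ⟨a.stage, a.pt, ?_⟩
  have h1 : SquaMS.map (e.hom ≫ e.inv) y = y := by rw [e.hom_inv_id, SquaMS.map_id]
  rw [← h1, SquaMS.map_comp, ← ha,
    ← hc.comp_coconePointUniqueUpToIso_inv (chainIsColimit A) a.stage]
  rfl

/-- The comparison morphism to the explicit colimit is short, so the limit distance is below `r`,
and then so is the distance at some finite stage. -/
theorem exists_dist_lt_of_isColimit {c : Cocone A} (hc : IsColimit c) {k l : ℕ}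
    (x : (A.obj k).carrier) (y : (A.obj l).carrier) {r : ℝ}
    (h : dist (SquaMS.map (c.ι.app k) x) (SquaMS.map (c.ι.app l) y) < r) :
    ∃ (n : ℕ) (hk : k ≤ n) (hl : l ≤ n), dist (chainMap A hk x) (chainMap A hl y) < r := by
  let e := hc.coconePointUniqueUpToIso (chainIsColimit A)
  have h1 := SquaMS.dist_map_le e.hom (SquaMS.map (c.ι.app k) x) (SquaMS.map (c.ι.app l) y)
  rw [← SquaMS.map_comp, ← SquaMS.map_comp, hc.comp_coconePointUniqueUpToIso_hom,
    hc.comp_coconePointUniqueUpToIso_hom] at h1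
  have h2 : chainDist (A := A) ⟨k, x⟩ ⟨l, y⟩ < r :=
    (SeparationQuotient.dist_mk _ _).symm.trans_lt (h1.trans_lt h)
  obtain ⟨N, hN⟩ := exists_dist_lt_of_chainDist_lt h2
  exact ⟨k + l + N, by omega, by omega, hN _ _ _ (by omega)⟩

/-- A compatible family of `K`-Lipschitz maps on a chain factors through the colimit. -/
theorem exists_lipschitz_desc {c : Cocone A} (hc : IsColimit c) {Y : Type u} [MetricSpace Y]
    {K : ℝ} (hK : 0 < K) (t : ∀ k, (A.obj k).carrier → Y)
    (ht : ∀ k n (h : k ≤ n) x, t n (chainMap A h x) = t k x)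
    (hd : ∀ k x y, dist (t k x) (t k y) ≤ K * dist x y) :
    ∃ g : c.pt.carrier → Y, (∀ k x, g (SquaMS.map (c.ι.app k) x) = t k x) ∧
      ∀ y z, dist (g y) (g z) ≤ K * dist y z := by
  -- The estimate is proved across different stages, so that it also shows that the choice of
  -- representatives below is immaterial. Dividing by `K` reduces it to an arbitrary `r` above the
  -- distance in the colimit, and such an `r` bounds the distance at some common stage.
  have key : ∀ k l x y, dist (t k x) (t l y) ≤
      K * dist (SquaMS.map (c.ι.app k) x) (SquaMS.map (c.ι.app l) y) := by
    intro k l x y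
    rw [mul_comm, ← div_le_iff₀ hK]
    refine le_of_forall_gt fun r hr => ?_
    obtain ⟨n, hk, hl, h⟩ := exists_dist_lt_of_isColimit hc x y hr
    rw [div_lt_iff₀ hK, mul_comm]
    rw [← ht k n hk, ← ht l n hl]
    exact (hd n _ _).trans_lt (mul_lt_mul_of_pos_left h hK)
  choose k x hkx using exists_rep_of_isColimit hc
  refine ⟨fun y => t (k y) (x y), fun l y => ?_, fun y z => ?_⟩
  · refine dist_le_zero.1 ((key _ _ _ _).trans_eq ?_)
    rw [hkx, dist_self, mul_zero]
  · have h := key (k y) (k z) (x y) (x z)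
    rwa [hkx, hkx] at h

end Chain

/-! ## Maps out of `I ⊗ X` -/

section Tensor

variable {I : Finset (Fin 3 × Fin 3)} {X Y : SquaMS.{u}}

theorem eq_of_glueSetoid {Z : Type*} {h : I × X.carrier → Z}
    (h1 : ∀ a b, Glue I X a b → h a = h b) {a b : I × X.carrier} (hab : glueSetoid I X a b) :
    h a = h b := by
  induction hab with
  | rel _ _ h => exact h1 _ _ h
  | refl _ => rfl
  | symm _ _ _ ih => exact ih.symm
  | trans _ _ _ _ _ ih ih' => exact ih.trans ih'

/-- Triangle inequality along the path: a pair related by `∼` has equal values, a pair in one cell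
is controlled by the Lipschitz bound, and a jump between cells costs `2`, which is at least the
diameter of `Y`. -/
theorem dist_le_score {h : I × X.carrier → Y.carrier} (h1 : ∀ a b, Glue I X a b → h a = h b)
    (h2 : ∀ m x y, dist (h (m, x)) (h (m, y)) ≤ 1 / 3 * dist x y) (n : ℕ)
    (f : ℕ → I × X.carrier) : dist (h (f 0)) (h (f n)) ≤ score I X n f := by
  refine dist_le_range_sum_of_dist_le (f := fun k => h (f k)) n fun {k} _ => ?_
  generalize f k = a, f (k + 1) = b
  obtain ⟨m, x⟩ := a
  obtain ⟨n, y⟩ := b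
  unfold step
  split_ifs with hab
  · rw [eq_of_glueSetoid h1 hab, dist_self]
  · unfold prodDist
    split_ifs with hmn
    · dsimp only at hmn
      subst hmn
      exact h2 _ _ _
    · exact Y.dist_le_two _ _

/-- The morphism on `I ⊗ X` given by a map on `I × X` which respects the gluing. -/
def tensorDesc [IsIndexSet I] (h : I × X.carrier → Y.carrier)
    (h1 : ∀ a b, Glue I X a b → h a = h b)
    (h2 : ∀ m x y, dist (h (m, x)) (h (m, y)) ≤ 1 / 3 * dist x y)
    (h3 : ∀ p, h (⟨outerCell p, mem_of_ne (outerCell_ne p)⟩, X.S (outerPoint p)) = Y.S p) :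
    tensorObj I X ⟶ Y where
  toFun := Quotient.lift h fun _ _ hab => eq_of_glueSetoid h1 hab
  short y z := by
    refine le_csInf (scores_nonempty (I := I) (X := X) y z) ?_
    rintro s ⟨n, f, rfl, rfl, rfl⟩
    exact dist_le_score h1 h2 n f
  map_S := h3

/-- The functor `I ⊗ -` preserves colimits of chains. -/
theorem tensorFunctor_preservesColimitsOfShape (I : Finset (Fin 3 × Fin 3)) [IsIndexSet I] :
    PreservesColimitsOfShape ℕ (tensorFunctor.{u} I) := by
  refine ⟨fun {A} => ⟨fun {c} hc => ⟨?_⟩⟩⟩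
  -- One cell at a time, the cocone is `1/3`-Lipschitz because `x ↦ m ⊗ x` is, so it descends to the
  -- colimit of the original chain.
  have hex : ∀ s : Cocone (A ⋙ tensorFunctor I), ∃ g : I → c.pt.carrier → s.pt.carrier,
      (∀ m k x, g m (SquaMS.map (c.ι.app k) x) =
        SquaMS.map (s.ι.app k) (Tensor.mk I (A.obj k) (m, x))) ∧
      ∀ m y z, dist (g m y) (g m z) ≤ 1 / 3 * dist y z := by
    intro s
    have := fun m : I => exists_lipschitz_desc hc (K := 1 / 3) (by norm_num)
      (fun k x => SquaMS.map (s.ι.app k) (Tensor.mk I (A.obj k) (m, x)))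
      (fun k n h x => cocone_chainMap s h (Tensor.mk I (A.obj k) (m, x)))
      (fun k x y => (SquaMS.dist_map_le (s.ι.app k) _ _).trans
        ((tensorDist_mk_le (m, x) (m, y)).trans_eq (if_pos rfl)))
    choose g hg hg' using this
    exact ⟨g, hg, hg'⟩
  choose g hg hg' using hex
  -- Boundary points of the colimit come from stage `0`. Compatibility with the gluing and with `S`
  -- thereby becomes a statement about `I ⊗ A 0`, where both hold.
  have hS : ∀ s m p, g s m (c.pt.S p) =
      SquaMS.map (s.ι.app 0) (Tensor.mk I (A.obj 0) (m, (A.obj 0).S p)) := fun s m p => by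
    rw [← hg, SquaMS.map_S]
  exact
    { desc := fun s => tensorDesc (fun a => g s a.1 a.2)
        (by
          rintro ⟨m, _⟩ ⟨n, _⟩ ⟨p, q, rfl, rfl, hE⟩
          dsimp only
          rw [hS, hS]
          exact congrArg _ (glue_of_eqvGen (Relation.EqvGen.rel _ _ hE)))
        (hg' s)
        (fun p => (hS s _ _).trans (SquaMS.map_S (s.ι.app 0) p))
      fac := fun s k => SquaMS.hom_ext fun y => by
        obtain ⟨a, rfl⟩ := Tensor.exists_mk y
        exact hg s a.1 k a.2
      uniq := fun s f hf => SquaMS.hom_ext fun y => by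
        obtain ⟨⟨m, y⟩, rfl⟩ := Tensor.exists_mk y
        obtain ⟨k, x, rfl⟩ := exists_rep_of_isColimit hc y
        exact (congrArg (fun φ => SquaMS.map φ (Tensor.mk I (A.obj k) (m, x))) (hf k)).trans
          (hg s m k x).symm }

/-! ## Injectivity -/

/-- Gluing acts on boundary points only, and injectivity of `S` lets chains of identifications be
composed in `I × M0`. So the relation between boundary points is witnessed by grid data that do not
depend on `X`. -/
theorem eq_or_boundary_of_glueSetoid {a b : I × X.carrier} (h : glueSetoid I X a b) :
    a = b ∨ ∃ p q : M0, a.2 = X.S p ∧ b.2 = X.S q ∧ Relation.EqvGen (Edge I) (a.1, p) (b.1, q) := by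
  induction h with
  | rel a b h =>
    obtain ⟨p, q, hp, hq, hE⟩ := h
    exact Or.inr ⟨p, q, hp, hq, Relation.EqvGen.rel _ _ hE⟩
  | refl _ => exact Or.inl rfl
  | symm _ _ _ ih =>
    rcases ih with rfl | ⟨p, q, hp, hq, hE⟩
    · exact Or.inl rfl
    · exact Or.inr ⟨q, p, hq, hp, Relation.EqvGen.symm _ _ hE⟩
  | trans _ _ _ _ _ ih ih' =>
    rcases ih with rfl | ⟨p, q, hp, hq, hE⟩
    · exact ih'
    rcases ih' with rfl | ⟨p', q', hp', hq', hE'⟩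
    · exact Or.inr ⟨p, q, hp, hq, hE⟩
    obtain rfl : q = p' := X.S_injective (hq.symm.trans hp')
    exact Or.inr ⟨p, q', hp, hq', Relation.EqvGen.trans _ _ _ hE hE'⟩

/-- The functor `I ⊗ -` preserves injectivity. -/
theorem tensorFunctor_map_injective (I : Finset (Fin 3 × Fin 3)) [IsIndexSet I] (f : X ⟶ Y)
    (hf : Function.Injective (SquaMS.map f)) :
    Function.Injective (SquaMS.map ((tensorFunctor I).map f)) := by
  intro y z h
  obtain ⟨⟨m, x⟩, rfl⟩ := Tensor.exists_mk y
  obtain ⟨⟨n, w⟩, rfl⟩ := Tensor.exists_mk z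
  have h' : glueSetoid I Y (m, SquaMS.map f x) (n, SquaMS.map f w) := Tensor.mk_eq.1 h
  rcases eq_or_boundary_of_glueSetoid h' with h | ⟨p, q, hp, hq, hE⟩
  · obtain ⟨rfl, h⟩ := Prod.ext_iff.1 h
    rw [hf h]
  -- Since `f` preserves `S` and is injective, only `X.S p` can be sent to `Y.S p`; the same
  -- identifications of boundary points are then available in `I ⊗ X`.
  · obtain rfl : x = X.S p := hf (hp.trans (SquaMS.map_S f p).symm)
    obtain rfl : w = X.S q := hf (hq.trans (SquaMS.map_S f q).symm)
    exact glue_of_eqvGen hE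

end Tensor

/-! ## Initial algebras -/

section InitialAlgebra

variable {F : SquaMS.{u} ⥤ SquaMS.{u}}

theorem initialChain_map_succ (k : ℕ) :
    (initialChain F).map (homOfLE (Nat.le_add_right k 1)) = iterMap F k :=
  Functor.ofSequence_map_homOfLE_succ _ k

theorem iterMap_coconeMap (c : Cocone (initialChain F)) (k : ℕ) :
    iterMap F k ≫ coconeMap c (k + 1) = coconeMap c k := by
  rw [← initialChain_map_succ]
  exact c.w _

/-- The cocone on the initial chain given by a compatible sequence of morphisms. -/
noncomputable def sequenceCocone {B : SquaMS.{u}} (b : ∀ k, iterObj F k ⟶ B)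
    (hb : ∀ k, iterMap F k ≫ b (k + 1) = b k) : Cocone (initialChain F) where
  pt := B
  ι := NatTrans.ofSequence b fun k => by
    rw [initialChain_map_succ]
    exact (hb k).trans (Category.comp_id _).symm

/-- The cocone on the image of the initial chain given by a compatible sequence of morphisms. -/
noncomputable def sequenceCoconeSucc {B : SquaMS.{u}} (b : ∀ k, iterObj F (k + 1) ⟶ B)
    (hb : ∀ k, iterMap F (k + 1) ≫ b (k + 1) = b k) : Cocone (initialChain F ⋙ F) where
  pt := B
  ι := NatTrans.ofSequence b fun k => by
    rw [Functor.comp_map, initialChain_map_succ]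
    exact (hb k).trans (Category.comp_id _).symm

theorem hom_ext_of_isColimit {c : Cocone (initialChain F)} (hc : IsColimit c) {B : SquaMS.{u}}
    {f g : c.pt ⟶ B} (h : ∀ k, coconeMap c k ≫ f = coconeMap c k ≫ g) : f = g :=
  hc.hom_ext h

theorem exists_desc {c : Cocone (initialChain F)} (hc : IsColimit c) {B : SquaMS.{u}}
    (b : ∀ k, iterObj F k ⟶ B) (hb : ∀ k, iterMap F k ≫ b (k + 1) = b k) :
    ∃ f : c.pt ⟶ B, ∀ k, coconeMap c k ≫ f = b k :=
  ⟨hc.desc (sequenceCocone b hb), fun k => hc.fac (sequenceCocone b hb) k⟩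

theorem map_hom_ext_of_isColimit [PreservesColimitsOfShape ℕ F] {c : Cocone (initialChain F)}
    (hc : IsColimit c) {B : SquaMS.{u}} {f g : F.obj c.pt ⟶ B}
    (h : ∀ k, F.map (coconeMap c k) ≫ f = F.map (coconeMap c k) ≫ g) : f = g :=
  (isColimitOfPreserves F hc).hom_ext h

/-- Applying `F` to the initial chain drops its first term, hence the shift of the index in `b`. -/
theorem exists_map_desc [PreservesColimitsOfShape ℕ F] {c : Cocone (initialChain F)}
    (hc : IsColimit c) {B : SquaMS.{u}} (b : ∀ k, iterObj F (k + 1) ⟶ B)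
    (hb : ∀ k, iterMap F (k + 1) ≫ b (k + 1) = b k) :
    ∃ f : F.obj c.pt ⟶ B, ∀ k, F.map (coconeMap c k) ≫ f = b k :=
  ⟨(isColimitOfPreserves F hc).desc (sequenceCoconeSucc b hb),
    fun k => (isColimitOfPreserves F hc).fac (sequenceCoconeSucc b hb) k⟩

/-- The morphisms from the initial chain to an algebra. -/
noncomputable def algebraLeg (B : Endofunctor.Algebra F) : ∀ k, iterObj F k ⟶ B.a
  | 0 => boundaryInitial.to B.a
  | k + 1 => F.map (algebraLeg B k) ≫ B.str

theorem iterMap_algebraLeg (B : Endofunctor.Algebra F) (k : ℕ) :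
    iterMap F k ≫ algebraLeg B (k + 1) = algebraLeg B k := by
  induction k with
  | zero => exact boundaryInitial.hom_ext _ _
  | succ k ih =>
    change F.map (iterMap F k) ≫ F.map (algebraLeg B (k + 1)) ≫ B.str = _
    rw [← Category.assoc, ← F.map_comp, ih]
    rfl

/-- The uniqueness half of initiality: the leg at `0` is forced by initiality of the boundary, and
the algebra square determines each leg from the previous one. -/
theorem coconeMap_algebra_hom {c : Cocone (initialChain F)} {η : F.obj c.pt ⟶ c.pt}
    (hη : ∀ k, F.map (coconeMap c k) ≫ η = coconeMap c (k + 1)) {B : Endofunctor.Algebra F}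
    {f : c.pt ⟶ B.a} (hf : F.map f ≫ B.str = η ≫ f) (k : ℕ) :
    coconeMap c k ≫ f = algebraLeg B k := by
  induction k with
  | zero => exact boundaryInitial.hom_ext _ _
  | succ k ih =>
    have h : (F.map (coconeMap c k) ≫ η) ≫ f = F.map (algebraLeg B k) ≫ B.str := by
      rw [Category.assoc, ← hf, ← Category.assoc, ← F.map_comp, ih]
    exact (congrArg (fun g => g ≫ f) (hη k)).symm.trans h

theorem isInitial_algebra [PreservesColimitsOfShape ℕ F] {c : Cocone (initialChain F)}
    (hc : IsColimit c) {η : F.obj c.pt ⟶ c.pt}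
    (hη : ∀ k, F.map (coconeMap c k) ≫ η = coconeMap c (k + 1)) :
    Nonempty (IsInitial (Endofunctor.Algebra.mk (F := F) c.pt η)) := by
  choose f hf using fun B : Endofunctor.Algebra F =>
    exists_desc hc (algebraLeg B) (iterMap_algebraLeg B)
  refine ⟨IsInitial.ofUniqueHom (fun B => ⟨f B, ?_⟩) fun B g => ?_⟩
  -- The algebra square is tested on the jointly epic maps `F.map (coconeMap c k)`, where both sides
  -- become the leg of `B` at `k + 1`.
  · refine map_hom_ext_of_isColimit hc fun k => ?_
    have h : F.map (coconeMap c k) ≫ F.map (f B) ≫ B.str = F.map (algebraLeg B k) ≫ B.str := by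
      rw [← Category.assoc, ← F.map_comp, hf]
    have h' : (F.map (coconeMap c k) ≫ η) ≫ f B = F.map (algebraLeg B k) ≫ B.str :=
      (congrArg (fun g => g ≫ f B) (hη k)).trans (hf B (k + 1))
    exact h.trans (h'.symm.trans (Category.assoc _ _ _))
  · refine Endofunctor.Algebra.Hom.ext (hom_ext_of_isColimit hc fun k => ?_)
    rw [coconeMap_algebra_hom hη g.h, hf]

/-- Lambek's lemma: the structure map of an initial algebra is invertible. -/
theorem isIso_of_coconeMap [PreservesColimitsOfShape ℕ F] {c : Cocone (initialChain F)}
    (hc : IsColimit c) {η : F.obj c.pt ⟶ c.pt}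
    (hη : ∀ k, F.map (coconeMap c k) ≫ η = coconeMap c (k + 1)) : IsIso η :=
  Endofunctor.Algebra.Initial.str_isIso (isInitial_algebra hc hη).some

/-- The leg at `0` is `S` of the colimit, injective by definition of a square metric space; `hη`
carries injectivity from each leg to the next. -/
theorem coconeMap_injective (hF : ∀ {X Y : SquaMS.{u}} (f : X ⟶ Y),
      Function.Injective (SquaMS.map f) → Function.Injective (SquaMS.map (F.map f)))
    {c : Cocone (initialChain F)} {η : F.obj c.pt ⟶ c.pt} (hinj : Function.Injective (SquaMS.map η))
    (hη : ∀ k, F.map (coconeMap c k) ≫ η = coconeMap c (k + 1)) (k : ℕ) :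
    Function.Injective (SquaMS.map (coconeMap c k)) := by
  induction k with
  | zero =>
    rintro ⟨p⟩ ⟨q⟩ h
    have hS : ∀ p : M0, SquaMS.map (coconeMap c 0) ⟨p⟩ = c.pt.S p :=
      SquaMS.map_S (X := boundaryObj) (coconeMap c 0)
    rw [hS, hS] at h
    rw [c.pt.S_injective h]
  | succ k ih =>
    rw [← hη]
    exact hinj.comp (hF _ ih)

/-- The colimit of the initial chain of `F` is an initial algebra. -/
theorem exists_initial_algebra [PreservesColimitsOfShape ℕ F]
    (hF : ∀ {X Y : SquaMS.{u}} (f : X ⟶ Y),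
      Function.Injective (SquaMS.map f) → Function.Injective (SquaMS.map (F.map f)))
    (c : Cocone (initialChain F)) (hc : IsColimit c) :
    ∃ η : F.obj c.pt ⟶ c.pt,
      (∀ k, F.map (coconeMap c k) ≫ η = coconeMap c (k + 1)) ∧
      (∀ a : F.obj c.pt ⟶ c.pt,
        (∀ k, F.map (coconeMap c k) ≫ a = coconeMap c (k + 1)) → a = η) ∧
      Nonempty (IsInitial (Endofunctor.Algebra.mk (F := F) c.pt η)) ∧
      IsIso η ∧ Isometry (SquaMS.map η) ∧
      ∀ k, Function.Injective (SquaMS.map (coconeMap c k)) := by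
  obtain ⟨η, hη⟩ := exists_map_desc hc (fun k => coconeMap c (k + 1))
    fun k => iterMap_coconeMap c (k + 1)
  have hiso := isIso_of_coconeMap hc hη
  have hisom := SquaMS.isometry_of_isIso η
  refine ⟨η, hη, fun a ha => map_hom_ext_of_isColimit hc fun k => ?_, isInitial_algebra hc hη,
    hiso, hisom, coconeMap_injective hF hisom.injective hη⟩
  rw [ha, hη]

end InitialAlgebra

end SquareMetric

theorem mainTheorem3 :
    HasColimitsOfShape ℕ SquaMS.{u} ∧
    PreservesColimitsOfShape ℕ functorM.{u} ∧
    PreservesColimitsOfShape ℕ functorN.{u} ∧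
    (∀ c : Cocone (initialChain functorM.{u}), IsColimit c →
      ∃ η : functorM.{u}.obj c.pt ⟶ c.pt,
        (∀ k, functorM.map (coconeMap c k) ≫ η = coconeMap c (k + 1)) ∧
        (∀ a : functorM.{u}.obj c.pt ⟶ c.pt,
          (∀ k, functorM.map (coconeMap c k) ≫ a = coconeMap c (k + 1)) → a = η) ∧
        Nonempty (IsInitial (Endofunctor.Algebra.mk (F := functorM.{u}) c.pt η)) ∧
        IsIso η ∧ Isometry (SquaMS.map η) ∧
        ∀ k, Function.Injective (SquaMS.map (coconeMap c k))) ∧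
    (∀ c : Cocone (initialChain functorN.{u}), IsColimit c →
      ∃ ν : functorN.{u}.obj c.pt ⟶ c.pt,
        (∀ k, functorN.map (coconeMap c k) ≫ ν = coconeMap c (k + 1)) ∧
        (∀ a : functorN.{u}.obj c.pt ⟶ c.pt,
          (∀ k, functorN.map (coconeMap c k) ≫ a = coconeMap c (k + 1)) → a = ν) ∧
        Nonempty (IsInitial (Endofunctor.Algebra.mk (F := functorN.{u}) c.pt ν)) ∧
        IsIso ν ∧ Isometry (SquaMS.map ν) ∧
        ∀ k, Function.Injective (SquaMS.map (coconeMap c k))) := by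
  have hM : PreservesColimitsOfShape ℕ functorM.{u} := tensorFunctor_preservesColimitsOfShape idxM
  have hN : PreservesColimitsOfShape ℕ functorN.{u} := tensorFunctor_preservesColimitsOfShape idxN
  exact ⟨hasColimitsOfShape_nat, hM, hN,
    exists_initial_algebra (tensorFunctor_map_injective idxM),
    exists_initial_algebra (tensorFunctor_map_injective idxN)⟩
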